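/- Let $N\ge 2$, $R>0$, $\Omega=B(0,R)\subset\mathbb R^N$, and let $g\in L^2(\Omega)$ be radial, i.e. $g(x)$ coincides for a.e. $x\in\Omega$ with a function of $|x|$. For $u\in L^1(\Omega)$ let $$TV(u)=\sup\Big\{\int_\Omega u\,\operatorname{div}\varphi\,dx \;:\; \varphi\in C_c^\infty(\Omega,\mathbb R^N),\ |\varphi|\le 1\Big\}\in[0,\infty],$$ and let $BV(\Omega)=\{u\in L^1(\Omega): TV(u)<\infty\}$. Regard $TV$ as a functional on $L^2(\Omega)$ with subdifferential $\partial TV(u)=\{p\in L^2(\Omega): TV(u)<\infty \text{ and } TV(v)\ge TV(u)+\langle p,v-u\rangle_{L^2(\Omega)}\ \forall v\in L^2(\Omega)\}$. Let $T>0$ and let $u$ be the solution (i.e. any solution, in the sense below) of the total variation flow $$-\partial_t u(t)\in\partial TV(u(t))\quad\text{for a.e. } t\in[0,T],\qquad u(0)=g,$$ where a solution is a continuous map $u:[0,T]\to L^2(\Omega)$ that is absolutely continuous on every compact subinterval of $(0,T)$ and satisfies the inclusion at a.e. $t$ (with $\partial_t u$ the derivative in $L^2(\Omega)$). Then for every $t\in(0,T]$,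 $u(t)$ belongs to $BV(\Omega)$ and is the unique minimizer (up to equality a.e. in $\Omega$) of $$\min_{v\in BV(\Omega)}\; t\,TV(v)+\tfrac12\|v-g\|_{L^2(\Omega)}^2,$$ where the energy is $+\infty$ if $v\notin L^2(\Omega)$. -/

import Mathlib

open MeasureTheory Set
open scoped ENNReal

noncomputable section

/-- The divergence `∑ i, ∂ᵢ φᵢ` of a vector field on `ℝᴺ`. -/
def divergence {N : ℕ} (φ : EuclideanSpace ℝ (Fin N) → EuclideanSpace ℝ (Fin N))
    (x : EuclideanSpace ℝ (Fin N)) : ℝ :=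
  ∑ i, (fderiv ℝ φ x (EuclideanSpace.single i 1)) i

/-- The admissible fields in the dual definition of the total variation:
`φ ∈ C_c^∞(Ω, ℝᴺ)` with `|φ(x)| ≤ 1` (Euclidean norm) for all `x ∈ Ω`. -/
def testFields {N : ℕ} (Ω : Set (EuclideanSpace ℝ (Fin N))) :
    Set (EuclideanSpace ℝ (Fin N) → EuclideanSpace ℝ (Fin N)) :=
  {φ | ContDiff ℝ (⊤ : ℕ∞) φ ∧ HasCompactSupport φ ∧ tsupport φ ⊆ Ω ∧ ∀ x ∈ Ω, ‖φ x‖ ≤ 1}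

/-- The total variation `TV(u) = |Du|(Ω) = sup {∫_Ω u div φ | φ admissible}` of `u ∈ L¹(Ω)`,
with values in `[0, ∞]`. The supremum is nonnegative, since `φ = 0` is admissible. -/
def totalVariation {N : ℕ} (Ω : Set (EuclideanSpace ℝ (Fin N)))
    (u : EuclideanSpace ℝ (Fin N) → ℝ) : ℝ≥0∞ :=
  ⨆ φ ∈ testFields Ω, ENNReal.ofReal (∫ x in Ω, u x * divergence φ x)

/-- `u ∈ BV(Ω)`: `u ∈ L¹(Ω)` and `TV(u) < ∞`. -/
def IsBV {N : ℕ} (Ω : Set (EuclideanSpace ℝ (Fin N)))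
    (u : EuclideanSpace ℝ (Fin N) → ℝ) : Prop :=
  IntegrableOn u Ω volume ∧ totalVariation Ω u < ∞

/-- The Hilbert space `L²(Ω)`. -/
abbrev L2 {N : ℕ} (Ω : Set (EuclideanSpace ℝ (Fin N))) : Type :=
  Lp ℝ 2 ((volume : Measure (EuclideanSpace ℝ (Fin N))).restrict Ω)

/-- The Rudin–Osher–Fatemi energy `lam * TV(u) + ½ ‖u - g‖²_{L²(Ω)}`, with values in `[0, ∞]`
(it is `∞` if `u - g ∉ L²(Ω)`). -/
def rofEnergy {N : ℕ} (Ω : Set (EuclideanSpace ℝ (Fin N))) (lam : ℝ)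
    (g u : EuclideanSpace ℝ (Fin N) → ℝ) : ℝ≥0∞ :=
  ENNReal.ofReal lam * totalVariation Ω u
    + 2⁻¹ * (eLpNorm (fun x => u x - g x) 2 (volume.restrict Ω)) ^ 2

/-- `u` minimizes the Rudin–Osher–Fatemi energy in `BV(Ω)`. -/
def IsROFMinimizer {N : ℕ} (Ω : Set (EuclideanSpace ℝ (Fin N))) (lam : ℝ)
    (g u : EuclideanSpace ℝ (Fin N) → ℝ) : Prop :=
  IsBV Ω u ∧ ∀ v, IsBV Ω v → rofEnergy Ω lam g u ≤ rofEnergy Ω lam g v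

/-- The subdifferential at `u` of a functional `F` with values in `[0, ∞]` on a real Hilbert
space: all `p` such that `F u < ∞` and `F u + ⟪p, v - u⟫ ≤ F v` for all `v`. -/
def subdifferential {H : Type*} [NormedAddCommGroup H] [InnerProductSpace ℝ H]
    (F : H → ℝ≥0∞) (u : H) : Set H :=
  {p | F u < ∞ ∧ ∀ v : H, (F u : EReal) + ((inner ℝ p (v - u) : ℝ) : EReal) ≤ (F v : EReal)}

/-- `u` is a (strong) solution on `[0, T]` of the total variation flow
`-∂ₜ u(t) ∈ ∂TV(u(t))` for a.e. `t ∈ [0, T]`, where `TV` is regarded as a functional on `L²(Ω)`: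
`u` is continuous from `[0, T]` to `L²(Ω)`, absolutely continuous on every compact subinterval of
`(0, T)`, and the inclusion holds almost everywhere. -/
structure IsTVFlow {N : ℕ} (Ω : Set (EuclideanSpace ℝ (Fin N))) (T : ℝ) (u : ℝ → L2 Ω) :
    Prop where
  continuousOn : ContinuousOn u (Icc 0 T)
  absolutelyContinuous : ∀ a b : ℝ, 0 < a → a ≤ b → b < T → AbsolutelyContinuousOnInterval u a b
  inclusion : ∀ᵐ t ∂(volume.restrict (Icc 0 T)), ∃ u' : L2 Ω, HasDerivAt u u' t ∧
    -u' ∈ subdifferential (fun v : L2 Ω => totalVariation Ω v) (u t)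

/-- `g` agrees a.e. in `Ω` with a function of `|x|`. -/
def IsRadial {N : ℕ} (Ω : Set (EuclideanSpace ℝ (Fin N)))
    (g : EuclideanSpace ℝ (Fin N) → ℝ) : Prop :=
  ∃ h : ℝ → ℝ, ∀ᵐ x ∂(volume.restrict Ω), g x = h ‖x‖

end

open scoped NNReal Topology RealInnerProductSpace
open Filter

section Hilbert

variable {H : Type*} [NormedAddCommGroup H] [InnerProductSpace ℝ H]

theorem mem_subdifferential_iff {F : H → ℝ≥0∞} {u p : H} :
    p ∈ subdifferential F u ↔
      F u < ∞ ∧ ∀ v, F v < ∞ → (F u).toReal + ⟪p, v - u⟫ ≤ (F v).toReal := by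
  refine and_congr_right fun hu => forall_congr' fun v => ?_
  rcases eq_or_ne (F v) ∞ with hv | hv
  · simp [hv]
  · have h1 : (F u : EReal) = (((F u).toReal : ℝ) : EReal) := by
      rw [← EReal.toReal_coe_ennreal, EReal.coe_toReal (by simpa using hu.ne) (by simp)]
    have h2 : (F v : EReal) = (((F v).toReal : ℝ) : EReal) := by
      rw [← EReal.toReal_coe_ennreal, EReal.coe_toReal (by simpa using hv) (by simp)]
    rw [h1, h2, ← EReal.coe_add, EReal.coe_le_coe_iff]
    simp [hv.lt_top]

theorem inner_sub_nonneg_of_mem_subdifferential {F : H → ℝ≥0∞} {u v p q : H}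
    (hp : p ∈ subdifferential F u) (hq : q ∈ subdifferential F v) :
    0 ≤ ⟪p - q, u - v⟫ := by
  rw [mem_subdifferential_iff] at hp hq
  have h1 := hp.2 v hq.1
  have h2 := hq.2 u hp.1
  rw [inner_sub_left]
  rw [← neg_sub u v, inner_neg_right] at h1
  linarith

/-- The resolvent equation `g = u + t • p`, `p ∈ ∂F(u)` determines `u`. -/
theorem eq_of_add_smul_subdifferential_eq {F : H → ℝ≥0∞} {u v p q : H} {t : ℝ} (ht : 0 < t)
    (hp : p ∈ subdifferential F u) (hq : q ∈ subdifferential F v)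
    (h : u + t • p = v + t • q) : u = v := by
  have h1 := inner_sub_nonneg_of_mem_subdifferential hp hq
  have h2 : u - v = -(t • (p - q)) := by
    rw [smul_sub, ← sub_eq_zero] at *
    rw [← h]; abel
  have h3 : p - q = 0 := by
    rw [h2, inner_neg_right, inner_smul_right, real_inner_self_eq_norm_sq] at h1
    have : ‖p - q‖ ^ 2 ≤ 0 := by nlinarith
    exact norm_eq_zero.1 (by nlinarith [norm_nonneg (p - q)])
  rw [h3] at h2
  simpa [sub_eq_zero] using h2

theorem AbsolutelyContinuousOnInterval.norm {E : Type*} [SeminormedAddCommGroup E]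
    {f : ℝ → E} {a b : ℝ} (hf : AbsolutelyContinuousOnInterval f a b) :
    AbsolutelyContinuousOnInterval (fun t => ‖f t‖) a b := by
  rw [absolutelyContinuousOnInterval_iff] at *
  intro ε hε
  obtain ⟨δ, hδ, h⟩ := hf ε hε
  refine ⟨δ, hδ, fun I hI hI' => lt_of_le_of_lt (Finset.sum_le_sum fun i _ => ?_) (h I hI hI')⟩
  rw [Real.dist_eq, dist_eq_norm]
  exact abs_norm_sub_norm_le _ _

theorem AbsolutelyContinuousOnInterval.le_of_ae_deriv_nonpos {f : ℝ → ℝ} {a b : ℝ} (hab : a ≤ b)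
    (hf : AbsolutelyContinuousOnInterval f a b)
    (h : ∀ᵐ t, t ∈ Ioc a b → deriv f t ≤ 0) : f b ≤ f a := by
  have h1 := hf.integral_deriv_eq_sub
  have h2 : ∫ t in a..b, deriv f t ≤ 0 := by
    rw [intervalIntegral.integral_of_le hab]
    exact setIntegral_nonpos_ae measurableSet_Ioc h
  linarith

/-- A gradient flow approaches every curve `v` whose backward difference quotients are
subgradients. -/
theorem norm_sub_le_of_gradientFlow {J : H → ℝ≥0∞} {T : ℝ} {u v : ℝ → H}
    (hu : ContinuousOn u (Icc 0 T))
    (hac : ∀ a b : ℝ, 0 < a → a ≤ b → b < T → AbsolutelyContinuousOnInterval u a b)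
    (hinc : ∀ᵐ t ∂(volume.restrict (Icc 0 T)), ∃ u', HasDerivAt u u' t ∧
      -u' ∈ subdifferential J (u t))
    {L : ℝ≥0} (hv : LipschitzOnWith L v (Ici 0))
    (hstep : ∀ s t, 0 ≤ s → s < t → (t - s)⁻¹ • (v s - v t) ∈ subdifferential J (v t)) :
    ∀ t ∈ Icc 0 T, ‖u t - v t‖ ≤ ‖u 0 - v 0‖ := by
  set φ : ℝ → ℝ := fun t => ‖u t - v t‖ * ‖u t - v t‖ with hφ
  have hφc : ContinuousOn φ (Icc 0 T) := by
    have : ContinuousOn (fun t => u t - v t) (Icc 0 T) :=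
      hu.sub (hv.continuousOn.mono Icc_subset_Ici_self)
    exact this.norm.mul this.norm
  have hφac : ∀ a b : ℝ, 0 < a → a ≤ b → b < T → AbsolutelyContinuousOnInterval φ a b := by
    intro a b ha hab hb
    have h1 : AbsolutelyContinuousOnInterval v a b := by
      refine LipschitzOnWith.absolutelyContinuousOnInterval (K := L) (hv.mono ?_)
      rw [uIcc_of_le hab]
      exact fun x hx => ha.le.trans hx.1
    have h2 := ((hac a b ha hab hb).sub h1).norm
    exact h2.mul h2
  have hderiv : ∀ᵐ t, t ∈ Ioo 0 T → deriv φ t ≤ 0 := by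
    filter_upwards [(ae_restrict_iff' measurableSet_Icc).1 hinc] with t ht ht0
    obtain ⟨u', hu', hsub⟩ := ht (Ioo_subset_Icc_self ht0)
    by_cases hd : DifferentiableAt ℝ φ t
    swap
    · rw [deriv_zero_of_not_differentiableAt hd]
    rw [mem_subdifferential_iff] at hsub
    have hφt := hd.hasDerivAt
    have key : ∀ s ∈ Ioo 0 t, (φ s - φ t) / (s - t) ≤
        2 * (⟪u t - v t, slope u t s⟫ + ((J (u t)).toReal - (J (v t)).toReal)) := by
      intro s hs
      have hst : 0 < t - s := sub_pos.2 hs.2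
      have h1 := hstep s t hs.1.le hs.2
      rw [mem_subdifferential_iff] at h1
      have h2 := h1.2 (u t) hsub.1
      have hq : v s - v t = (t - s) • ((t - s)⁻¹ • (v s - v t)) := by
        rw [smul_inv_smul₀ hst.ne']
      set q := (t - s)⁻¹ • (v s - v t)
      have hus : u s - u t = -((t - s) • slope u t s) := by
        rw [slope_def_module, ← smul_assoc]
        have : (t - s) • (s - t)⁻¹ = (-1 : ℝ) := by
          rw [smul_eq_mul, ← neg_sub s t, neg_mul, mul_inv_cancel₀ (by linarith)]
        rw [this]; simp
      have hw : u s - v s = (u t - v t) + -((t - s) • (slope u t s + q)) := by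
        have : u s - v s = (u t - v t) + (u s - u t) - (v s - v t) := by abel
        rw [this, hus, hq, smul_add]; abel
      have h3 : φ s - φ t ≥ -(2 * (t - s) * ⟪u t - v t, slope u t s + q⟫) := by
        simp only [hφ]
        rw [← real_inner_self_eq_norm_mul_norm, ← real_inner_self_eq_norm_mul_norm, hw,
          real_inner_add_add_self, inner_neg_right, inner_smul_right]
        have := real_inner_self_nonneg (x := -((t - s) • (slope u t s + q)))
        linarith
      rw [div_le_iff_of_neg (by linarith)]
      rw [inner_add_right] at h3
      rw [real_inner_comm] at h2
      nlinarith
    have hlim1 : Tendsto (fun s => (φ s - φ t) / (s - t)) (𝓝[<] t) (𝓝 (deriv φ t)) := by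
      have := (hasDerivAt_iff_tendsto_slope.1 hφt).mono_left
        (nhdsWithin_mono t (fun s (hs : s < t) => hs.ne))
      refine this.congr fun s => ?_
      rw [slope_def_field]
    have hlim2 : Tendsto (fun s => 2 * (⟪u t - v t, slope u t s⟫
        + ((J (u t)).toReal - (J (v t)).toReal))) (𝓝[<] t)
        (𝓝 (2 * (⟪u t - v t, u'⟫ + ((J (u t)).toReal - (J (v t)).toReal)))) := by
      have := (hasDerivAt_iff_tendsto_slope.1 hu').mono_left
        (nhdsWithin_mono t (fun s (hs : s < t) => hs.ne))
      exact ((tendsto_const_nhds.inner this).add_const _).const_mul _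
    have hle := le_of_tendsto_of_tendsto hlim1 hlim2
      (by filter_upwards [Ioo_mem_nhdsLT ht0.1] with s hs using key s hs)
    have h4 := hsub.2 (v t) (hstep 0 t le_rfl ht0.1).1
    have h5 : ⟪-u', v t - u t⟫ = ⟪u t - v t, u'⟫ := by
      rw [← neg_sub (u t) (v t), inner_neg_neg, real_inner_comm]
    linarith
  have hmono : ∀ a b : ℝ, 0 < a → a ≤ b → b < T → φ b ≤ φ a := fun a b ha hab hb =>
    (hφac a b ha hab hb).le_of_ae_deriv_nonpos hab (by
      filter_upwards [hderiv] with t ht hmem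
      exact ht ⟨ha.trans hmem.1, hmem.2.trans_lt hb⟩)
  have hanti : AntitoneOn φ (Ioo 0 T) := fun a ha b hb hab => hmono a b ha.1 hab hb.2
  intro t ht
  have hT : 0 ≤ T := ht.1.trans ht.2
  rcases hT.eq_or_lt with rfl | hT
  · rw [le_antisymm ht.2 ht.1]
  have h0 : ∀ t ∈ Ioo 0 T, φ t ≤ φ 0 := by
    intro t ht
    have hlim : Tendsto φ (𝓝[>] 0) (𝓝 (φ 0)) :=
      (hφc 0 (left_mem_Icc.2 hT.le)).mono_left
        (nhdsWithin_le_of_mem (Icc_mem_nhdsGT_of_mem (left_mem_Ico.2 hT)))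
    refine ge_of_tendsto hlim ?_
    filter_upwards [Ioo_mem_nhdsGT ht.1] with a ha using hmono a t ha.1 ha.2.le ht.2
  have h1 : φ t ≤ φ 0 := by
    rcases ht.1.eq_or_lt with rfl | ht0
    · exact le_rfl
    rcases ht.2.eq_or_lt with rfl | htT
    · have hlim : Tendsto φ (𝓝[<] t) (𝓝 (φ t)) :=
        (hφc t (right_mem_Icc.2 hT.le)).mono_left
          (nhdsWithin_le_of_mem (Icc_mem_nhdsLT_of_mem (right_mem_Ioc.2 hT)))
      refine le_of_tendsto hlim ?_
      filter_upwards [Ioo_mem_nhdsLT ht0] with a ha using h0 a ha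
    · exact h0 t ⟨ht0, htT⟩
  exact (mul_self_le_mul_self_iff (norm_nonneg _) (norm_nonneg _)).2 h1

/-- `p` is spanned by `b`, lies in the box `|⟪p, b j⟫| ≤ c j`, and attains the bound `c j` with
the sign of the coefficient `⟪bd j, v⟫` of `v` along `b j` whenever that coefficient is nonzero. -/
structure IsCalibrated {ι : Type*} (b bd : ι → H) (c : ι → ℝ) (v p : H) : Prop where
  mem_span_left : v ∈ Submodule.span ℝ (range b)
  mem_span_right : p ∈ Submodule.span ℝ (range b)
  abs_le : ∀ j, |⟪p, b j⟫| ≤ c j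
  eq_abs : ∀ j, ⟪bd j, v⟫ * ⟪p, b j⟫ = c j * |⟪bd j, v⟫|

section Biorthogonal

variable {ι : Type*} [Fintype ι] [DecidableEq ι] {b bd : ι → H} {c : ι → ℝ}

theorem sum_inner_dual_smul_eq (hbi : ∀ i j, ⟪bd i, b j⟫ = if i = j then 1 else 0) {v : H}
    (hv : v ∈ Submodule.span ℝ (range b)) : ∑ j, ⟪bd j, v⟫ • b j = v := by
  obtain ⟨a, rfl⟩ := (Submodule.mem_span_range_iff_exists_fun ℝ).1 hv
  refine Finset.sum_congr rfl fun j _ => ?_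
  simp [inner_sum, inner_smul_right, hbi]

theorem sum_inner_smul_dual_eq (hbi : ∀ i j, ⟪bd i, b j⟫ = if i = j then 1 else 0)
    (hspan : ∀ i, bd i ∈ Submodule.span ℝ (range b)) {p : H}
    (hp : p ∈ Submodule.span ℝ (range b)) : ∑ j, ⟪p, b j⟫ • bd j = p := by
  set d := ∑ j, ⟪p, b j⟫ • bd j - p with hd
  have hd1 : d ∈ Submodule.span ℝ (range b) :=
    sub_mem (sum_mem fun j _ => Submodule.smul_mem _ _ (hspan j)) hp
  have hd2 : ∀ j, ⟪d, b j⟫ = 0 := by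
    intro j
    simp [hd, inner_sub_left, sum_inner, inner_smul_left, hbi]
  have h3 : ⟪d, d⟫ = 0 := by
    conv_lhs => rw [← sum_inner_dual_smul_eq hbi hd1]
    rw [inner_sum]
    refine Finset.sum_eq_zero fun j _ => ?_
    rw [inner_smul_right, sum_inner_dual_smul_eq hbi hd1, hd2, mul_zero]
  exact sub_eq_zero.1 (inner_self_eq_zero.1 h3)

theorem exists_isCalibrated (hc : ∀ i, 0 ≤ c i)
    (hbi : ∀ i j, ⟪bd i, b j⟫ = if i = j then 1 else 0)
    (hspan : ∀ i, bd i ∈ Submodule.span ℝ (range b)) {g : H}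
    (hg : g ∈ Submodule.span ℝ (range b)) {t : ℝ} (ht : 0 < t) :
    ∃ p, IsCalibrated b bd c (g - t • p) p := by
  let P : (ι → ℝ) → H := fun F => ∑ j, F j • bd j
  have hP : Continuous P := by fun_prop
  have hPb : ∀ F j, ⟪P F, b j⟫ = F j := by
    intro F j
    simp [P, sum_inner, inner_smul_left, hbi]
  have hPs : ∀ F, P F ∈ Submodule.span ℝ (range b) := fun F =>
    sum_mem fun j _ => Submodule.smul_mem _ _ (hspan j)
  obtain ⟨F, hF, hmin⟩ := (isCompact_Icc (a := fun j => -c j) (b := c)).exists_isMinOn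
    ⟨c, fun j => by dsimp; linarith [hc j], le_rfl⟩
    (f := fun F => ‖g - t • P F‖ ^ 2) (by fun_prop)
  refine ⟨P F, ⟨sub_mem hg (Submodule.smul_mem _ _ (hPs F)), hPs F, fun j => ?_, fun j => ?_⟩⟩
  · rw [hPb]; exact abs_le.2 ⟨hF.1 j, hF.2 j⟩
  rw [hPb]
  set v := g - t • P F with hv
  have key : ∀ s ∈ Icc (-c j) (c j), ⟪bd j, v⟫ * (s - F j) ≤ 0 := by
    intro s hs
    by_contra! hpos
    have hquad : ∀ ε ∈ Ioc (0 : ℝ) 1,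
        2 * t * (⟪bd j, v⟫ * (s - F j)) ≤ ε * (t ^ 2 * (s - F j) ^ 2 * ‖bd j‖ ^ 2) := by
      intro ε hε
      set F' : ι → ℝ := fun i => F i + if i = j then ε * (s - F j) else 0 with hF'
      have hmem : F' ∈ Icc (fun j => -c j) c := by
        have h1 : -c j ≤ F j := hF.1 j
        have h2 := hF.2 j
        refine ⟨fun i => ?_, fun i => ?_⟩
        · rcases eq_or_ne i j with rfl | hij
          · simp only [hF', if_true]
            nlinarith [hε.1, hε.2, hs.1, hs.2]
          · simpa [hF', hij] using hF.1 i
        · rcases eq_or_ne i j with rfl | hij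
          · simp only [hF', if_true]
            nlinarith [hε.1, hε.2, hs.1, hs.2]
          · simpa [hF', hij] using hF.2 i
      have h1 : ‖v‖ ^ 2 ≤ ‖g - t • P F'‖ ^ 2 := hmin hmem
      have h2 : P F' = P F + (ε * (s - F j)) • bd j := by
        simp [P, hF', add_smul, Finset.sum_add_distrib, ite_smul]
      have h3 : g - t • P F'
          = v - (t * ε * (s - F j)) • bd j := by
        rw [h2, hv, smul_add, smul_smul, ← mul_assoc]; abel
      rw [h3, norm_sub_sq_real v, inner_smul_right, real_inner_comm, norm_smul, mul_pow,
        Real.norm_eq_abs, sq_abs] at h1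
      have h4 := hε.1
      by_contra! h5
      nlinarith [mul_lt_mul_of_pos_left h5 h4]
    set A := t ^ 2 * (s - F j) ^ 2 * ‖bd j‖ ^ 2 with hA
    have hA0 : 0 ≤ A := by positivity
    set B := 2 * t * (⟪bd j, v⟫ * (s - F j)) with hB
    have hB0 : 0 < B := by positivity
    have := hquad (min 1 (B / (2 * (A + 1)))) ⟨lt_min one_pos (by positivity), min_le_left _ _⟩
    have h6 : min 1 (B / (2 * (A + 1))) * A ≤ B / (2 * (A + 1)) * A :=
      mul_le_mul_of_nonneg_right (min_le_right _ _) hA0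
    have h7 : B / (2 * (A + 1)) * A ≤ B / 2 := by
      rw [div_mul_eq_mul_div, div_le_div_iff₀ (by positivity) two_pos]
      nlinarith
    linarith
  have h1 := hF.1 j
  have h2 := hF.2 j
  dsimp at h1
  rcases le_total 0 ⟪bd j, v⟫ with h | h
  · rw [abs_of_nonneg h]
    have := key (c j) ⟨by linarith [hc j], le_rfl⟩
    nlinarith
  · rw [abs_of_nonpos h]
    have := key (-c j) ⟨le_rfl, by linarith [hc j]⟩
    nlinarith

theorem IsCalibrated.mem_subdifferential (hbi : ∀ i j, ⟪bd i, b j⟫ = if i = j then 1 else 0)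
    {J : H → ℝ≥0∞} (hJb : ∀ a : ι → ℝ, J (∑ j, a j • b j) ≤ ENNReal.ofReal (∑ j, c j * |a j|))
    (hJp : ∀ p ∈ Submodule.span ℝ (range b), (∀ j, |⟪p, b j⟫| ≤ c j) →
      ∀ w, J w < ∞ → ⟪p, w⟫ ≤ (J w).toReal)
    {v p : H} (h : IsCalibrated b bd c v p) : p ∈ subdifferential J v := by
  have h1 := hJb fun j => ⟪bd j, v⟫
  have h2 : ∑ j, c j * |⟪bd j, v⟫| = ⟪p, v⟫ := by
    conv_rhs => rw [← sum_inner_dual_smul_eq hbi h.mem_span_left, inner_sum]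
    refine Finset.sum_congr rfl fun j _ => ?_
    rw [← h.eq_abs j, inner_smul_right]
  rw [sum_inner_dual_smul_eq hbi h.mem_span_left, h2] at h1
  rw [mem_subdifferential_iff]
  refine ⟨h1.trans_lt ENNReal.ofReal_lt_top, fun w hw => ?_⟩
  have h3 := hJp p h.mem_span_right h.abs_le w hw
  have h4 : (J v).toReal ≤ ⟪p, v⟫ := by
    refine ENNReal.toReal_le_of_le_ofReal ?_ h1
    rw [← h2]
    exact Finset.sum_nonneg fun j _ =>
      mul_nonneg ((abs_nonneg _).trans (h.abs_le j)) (abs_nonneg _)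
  rw [inner_sub_right]
  linarith

omit [Fintype ι] [DecidableEq ι] in
theorem IsCalibrated.smul_add_smul {v p q : H} (hp : IsCalibrated b bd c v p)
    (hq : IsCalibrated b bd c v q) {α β : ℝ} (hα : 0 ≤ α) (hβ : 0 ≤ β) (hαβ : α + β = 1) :
    IsCalibrated b bd c v (α • p + β • q) where
  mem_span_left := hp.mem_span_left
  mem_span_right := add_mem (Submodule.smul_mem _ _ hp.mem_span_right)
    (Submodule.smul_mem _ _ hq.mem_span_right)
  abs_le j := by
    have h1 := _root_.abs_le.1 (hp.abs_le j)
    have h2 := _root_.abs_le.1 (hq.abs_le j)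
    rw [inner_add_left, real_inner_smul_left, real_inner_smul_left]
    obtain rfl : β = 1 - α := by linarith
    exact _root_.abs_le.2 ⟨by nlinarith, by nlinarith⟩
  eq_abs j := by
    have h1 := hp.eq_abs j
    have h2 := hq.eq_abs j
    rw [inner_add_left, real_inner_smul_left, real_inner_smul_left]
    linear_combination α * h1 + β * h2 + c j * |⟪bd j, v⟫| * hαβ

omit [Fintype ι] [DecidableEq ι] in
/-- A calibration survives a resolvent step, when saturation of the constraint `j` by an
element of the box forces its `j`-th coefficient to have the sign of the constraint. -/
theorem IsCalibrated.of_resolvent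
    (hsign : ∀ q ∈ Submodule.span ℝ (range b), (∀ i, |⟪q, b i⟫| ≤ c i) →
      ∀ j, 0 < c j → ⟪q, b j⟫ = c j → 0 ≤ ⟪bd j, q⟫)
    {v w p q : H} {h : ℝ} (hh : 0 ≤ h) (hp : IsCalibrated b bd c v p)
    (hq : IsCalibrated b bd c w q) (hv : v = w + h • q) : IsCalibrated b bd c w p where
  mem_span_left := hq.mem_span_left
  mem_span_right := hp.mem_span_right
  abs_le := hp.abs_le
  eq_abs j := by
    rcases ((abs_nonneg _).trans (hp.abs_le j)).eq_or_lt with hc0 | hc0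
    · have := hp.abs_le j
      rw [← hc0] at this ⊢
      rw [abs_nonpos_iff.1 this]; simp
    have hpj := hp.eq_abs j
    have hqj := hq.eq_abs j
    have hvj : ⟪bd j, v⟫ = ⟪bd j, w⟫ + h * ⟪bd j, q⟫ := by
      rw [hv, inner_add_right, inner_smul_right]
    rcases lt_trichotomy ⟪bd j, w⟫ 0 with hw | hw | hw
    · rw [abs_of_neg hw] at hqj ⊢
      have h1 : ⟪q, b j⟫ = -c j := by
        apply mul_left_cancel₀ hw.ne; linarith
      have h2 := hsign (-q) (neg_mem hq.mem_span_right)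
        (fun i => by rw [inner_neg_left, abs_neg]; exact hq.abs_le i) j hc0
        (by rw [inner_neg_left, h1, neg_neg])
      rw [inner_neg_right] at h2
      have h3 : ⟪bd j, v⟫ < 0 := by rw [hvj]; nlinarith
      rw [abs_of_neg h3] at hpj
      have h4 : ⟪p, b j⟫ = -c j := by
        apply mul_left_cancel₀ h3.ne; linarith
      rw [h4]; ring
    · rw [hw]; simp
    · rw [abs_of_pos hw] at hqj ⊢
      have h1 : ⟪q, b j⟫ = c j := by
        apply mul_left_cancel₀ hw.ne'; linarith
      have h2 := hsign q hq.mem_span_right hq.abs_le j hc0 h1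
      have h3 : 0 < ⟪bd j, v⟫ := by rw [hvj]; positivity
      rw [abs_of_pos h3] at hpj
      have h4 : ⟪p, b j⟫ = c j := by
        apply mul_left_cancel₀ h3.ne'; linarith
      rw [h4]; ring

/-- The resolvents of `J` at an element of the span of `b` form a curve whose backward difference
quotients are subgradients. -/
theorem exists_resolvent_curve (hc : ∀ i, 0 ≤ c i)
    (hbi : ∀ i j, ⟪bd i, b j⟫ = if i = j then 1 else 0)
    (hspan : ∀ i, bd i ∈ Submodule.span ℝ (range b))
    {J : H → ℝ≥0∞} (hJb : ∀ a : ι → ℝ, J (∑ j, a j • b j) ≤ ENNReal.ofReal (∑ j, c j * |a j|))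
    (hJp : ∀ p ∈ Submodule.span ℝ (range b), (∀ j, |⟪p, b j⟫| ≤ c j) →
      ∀ w, J w < ∞ → ⟪p, w⟫ ≤ (J w).toReal)
    (hsign : ∀ q ∈ Submodule.span ℝ (range b), (∀ i, |⟪q, b i⟫| ≤ c i) →
      ∀ j, 0 < c j → ⟪q, b j⟫ = c j → 0 ≤ ⟪bd j, q⟫)
    {g : H} (hg : g ∈ Submodule.span ℝ (range b)) :
    ∃ (v : ℝ → H) (L : ℝ≥0), v 0 = g ∧ LipschitzOnWith L v (Ici 0) ∧
      ∀ s t, 0 ≤ s → s < t → (t - s)⁻¹ • (v s - v t) ∈ subdifferential J (v t) := by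
  have hex : ∀ t : ℝ, ∃ p, 0 < t → IsCalibrated b bd c (g - t • p) p := by
    intro t
    by_cases ht : 0 < t
    · obtain ⟨p, hp⟩ := exists_isCalibrated hc hbi hspan hg ht
      exact ⟨p, fun _ => hp⟩
    · exact ⟨0, fun h => absurd h ht⟩
  choose P hP using hex
  have hcal : ∀ s t, 0 ≤ s → s < t → ∃ q, IsCalibrated b bd c (g - t • P t) q ∧
      g - s • P s - (g - t • P t) = (t - s) • q := by
    intro s t hs hst
    rcases hs.eq_or_lt with rfl | hs
    · exact ⟨P t, hP t hst, by simp⟩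
    have ht := hs.trans hst
    have hts := sub_pos.2 hst
    have hps := hP s hs
    obtain ⟨q, hq⟩ := exists_isCalibrated hc hbi hspan hps.mem_span_left hts
    have hpw := IsCalibrated.of_resolvent hsign hts.le hps hq (by abel)
    have hconv := hpw.smul_add_smul hq (α := s / t) (β := (t - s) / t) (by positivity)
      (by positivity) (by field_simp; ring)
    have heq : g - s • P s - (t - s) • q = g - t • P t := by
      refine eq_of_add_smul_subdifferential_eq ht (hconv.mem_subdifferential hbi hJb hJp)
        ((hP t ht).mem_subdifferential hbi hJb hJp) ?_
      rw [smul_add, smul_smul, smul_smul, mul_div_cancel₀ _ ht.ne', mul_div_cancel₀ _ ht.ne']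
      abel
    refine ⟨q, heq ▸ hq, ?_⟩
    rw [← heq]; abel
  have hbound : ∀ v q, IsCalibrated b bd c v q → ‖q‖ ≤ ∑ j, c j * ‖bd j‖ := by
    intro v q hq
    rw [← sum_inner_smul_dual_eq hbi hspan hq.mem_span_right]
    refine (norm_sum_le _ _).trans (Finset.sum_le_sum fun j _ => ?_)
    rw [norm_smul]
    exact mul_le_mul_of_nonneg_right (hq.abs_le j) (norm_nonneg _)
  have hL : 0 ≤ ∑ j, c j * ‖bd j‖ :=
    Finset.sum_nonneg fun j _ => mul_nonneg (hc j) (norm_nonneg _)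
  refine ⟨fun t => g - t • P t, ⟨_, hL⟩, by simp, ?_, fun s t hs hst => ?_⟩
  · refine LipschitzOnWith.of_dist_le_mul fun s hs t ht => ?_
    wlog hst : s < t generalizing s t
    · rcases (not_lt.1 hst).eq_or_lt with rfl | h
      · simp
      · rw [dist_comm, dist_comm s]; exact this t ht s hs h
    obtain ⟨q, hq, hq'⟩ := hcal s t hs hst
    rw [dist_eq_norm, hq', norm_smul, dist_comm, Real.dist_eq, Real.norm_eq_abs, mul_comm]
    exact mul_le_mul_of_nonneg_right (hbound _ _ hq) (abs_nonneg _)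
  · obtain ⟨q, hq, hq'⟩ := hcal s t hs hst
    rw [hq', inv_smul_smul₀ (sub_pos.2 hst).ne']
    exact hq.mem_subdifferential hbi hJb hJp

end Biorthogonal

end Hilbert

section RadialCalculus

theorem hasFDerivAt_norm_of_ne_zero {E : Type*} [NormedAddCommGroup E] [InnerProductSpace ℝ E]
    {x : E} (hx : x ≠ 0) : HasFDerivAt (fun y : E => ‖y‖) (‖x‖⁻¹ • innerSL ℝ x) x := by
  have h := (hasStrictFDerivAt_norm_sq x).hasFDerivAt.sqrt (by positivity)
  have h2 : (fun y : E => ‖y‖) = fun y => √(‖y‖ ^ 2) := by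
    ext y; rw [Real.sqrt_sq (norm_nonneg _)]
  rw [h2]
  convert h using 1
  rw [Real.sqrt_sq (norm_nonneg _), two_nsmul, ← two_smul ℝ, smul_smul]
  congr 1
  field_simp

theorem contDiff_comp_norm {E F : Type*} [NormedAddCommGroup E] [InnerProductSpace ℝ E]
    [NormedAddCommGroup F] [NormedSpace ℝ F] {f : ℝ → F} (hf : ContDiff ℝ (⊤ : ℕ∞) f)
    (h0 : ∀ᶠ s in 𝓝 (0 : ℝ), f s = f 0) :
    ContDiff ℝ (⊤ : ℕ∞) (fun x : E => f ‖x‖) := by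
  rw [contDiff_iff_contDiffAt]
  intro x
  rcases eq_or_ne x 0 with rfl | hx
  · have h1 : Tendsto (fun x : E => ‖x‖) (𝓝 0) (𝓝 0) := tendsto_norm_zero
    refine (contDiffAt_const (c := f 0)).congr_of_eventuallyEq ?_
    filter_upwards [h1.eventually h0] with y hy using hy
  · exact hf.contDiffAt.comp x (contDiffAt_norm ℝ hx)

theorem hasFDerivAt_comp_norm {E : Type*} [NormedAddCommGroup E] [InnerProductSpace ℝ E]
    {f : ℝ → ℝ} {f' : ℝ} {x : E} (hx : x ≠ 0) (hf : HasDerivAt f f' ‖x‖) :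
    HasFDerivAt (fun y : E => f ‖y‖) ((f' * ‖x‖⁻¹) • innerSL ℝ x) x := by
  have := hf.comp_hasFDerivAt x (hasFDerivAt_norm_of_ne_zero hx)
  rwa [smul_smul] at this

variable {N : ℕ}

theorem divergence_smul_id (κ : ℝ) (x : EuclideanSpace ℝ (Fin N)) :
    divergence (fun y => κ • y) x = N * κ := by
  have h : fderiv ℝ (fun y : EuclideanSpace ℝ (Fin N) => κ • y) x
      = κ • ContinuousLinearMap.id ℝ _ := ((hasFDerivAt_id x).const_smul κ).fderiv
  simp [divergence, h]

theorem divergence_congr {φ ψ : EuclideanSpace ℝ (Fin N) → EuclideanSpace ℝ (Fin N)}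
    {x : EuclideanSpace ℝ (Fin N)} (h : φ =ᶠ[𝓝 x] ψ) : divergence φ x = divergence ψ x := by
  simp only [divergence, h.fderiv_eq]

theorem divergence_comp_norm_smul {M : ℝ → ℝ} {M' : ℝ} {x : EuclideanSpace ℝ (Fin N)}
    (hx : x ≠ 0) (hM : HasDerivAt M M' ‖x‖) :
    divergence (fun y => M ‖y‖ • y) x = N * M ‖x‖ + M' * ‖x‖ := by
  have h : fderiv ℝ (fun y => M ‖y‖ • y) x = M ‖x‖ • ContinuousLinearMap.id ℝ _
      + ((M' * ‖x‖⁻¹) • innerSL ℝ x).smulRight x :=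
    ((hasFDerivAt_comp_norm hx hM).smul (hasFDerivAt_id x)).fderiv
  have h2 : ∑ i, x i * x i = ‖x‖ ^ 2 := by
    rw [EuclideanSpace.real_norm_sq_eq]
    exact Finset.sum_congr rfl fun i _ => (sq _).symm
  have hx' : ‖x‖ ≠ 0 := norm_ne_zero_iff.2 hx
  have h3 : divergence (fun y => M ‖y‖ • y) x
      = ∑ i, (M ‖x‖ + M' * ‖x‖⁻¹ * (x i * x i)) := by
    refine Finset.sum_congr rfl fun i _ => ?_
    rw [h]
    simp [EuclideanSpace.inner_single_right]
    ring
  rw [h3, Finset.sum_add_distrib, ← Finset.mul_sum, h2]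
  simp
  field_simp

/-- A profile `Ψ` in the variable `|x|^N` gives the radial field `Ψ(|x|^N) / (N |x|^N) • x`, whose
divergence is `Ψ'(|x|^N)`. -/
theorem exists_testField_divergence_eq (hN : N ≠ 0) {R R' κ : ℝ} (hR' : R' < R) {Ψ : ℝ → ℝ}
    (hΨ : ContDiff ℝ (⊤ : ℕ∞) Ψ) (h0 : ∀ᶠ s in 𝓝 (0 : ℝ), Ψ s = κ * s)
    (hsupp : ∀ r, R' ≤ r → Ψ (r ^ N) = 0) (hle : ∀ r, 0 ≤ r → |Ψ (r ^ N)| ≤ N * r ^ (N - 1)) :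
    ∃ φ ∈ testFields (Metric.ball (0 : EuclideanSpace ℝ (Fin N)) R),
      ∀ x, divergence φ x = deriv Ψ (‖x‖ ^ N) := by
  have hN' : (N : ℝ) ≠ 0 := Nat.cast_ne_zero.2 hN
  set M : ℝ → ℝ := fun r => Ψ (r ^ N) / (N * r ^ N) with hM
  set φ : EuclideanSpace ℝ (Fin N) → EuclideanSpace ℝ (Fin N) := fun x => M ‖x‖ • x with hφ
  have hpow : Tendsto (fun x : EuclideanSpace ℝ (Fin N) => ‖x‖ ^ N) (𝓝 0) (𝓝 0) := by
    have : Continuous fun x : EuclideanSpace ℝ (Fin N) => ‖x‖ ^ N := by fun_prop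
    simpa [hN] using this.tendsto 0
  have hnear : φ =ᶠ[𝓝 0] fun x => (κ / N) • x := by
    filter_upwards [hpow.eventually h0] with x hx
    rcases eq_or_ne x 0 with rfl | hx0
    · simp [hφ]
    · have : ‖x‖ ^ N ≠ 0 := pow_ne_zero _ (norm_ne_zero_iff.2 hx0)
      simp only [hφ, hM, hx]
      congr 1
      field_simp
  have hzero : ∀ x ∉ Metric.closedBall (0 : EuclideanSpace ℝ (Fin N)) R', φ x = 0 := by
    intro x hx
    rw [mem_closedBall_zero_iff, not_le] at hx
    simp [hφ, hM, hsupp _ hx.le]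
  have hts : tsupport φ ⊆ Metric.closedBall (0 : EuclideanSpace ℝ (Fin N)) R' :=
    closure_minimal (fun x hx => by
      by_contra h
      exact hx (hzero x h)) Metric.isClosed_closedBall
  refine ⟨φ, ⟨?_, ?_, ?_, ?_⟩, ?_⟩
  · rw [contDiff_iff_contDiffAt]
    intro x
    rcases eq_or_ne x 0 with rfl | hx
    · exact (contDiff_id.const_smul (κ / N)).contDiffAt.congr_of_eventuallyEq hnear
    · have h1 := contDiffAt_norm ℝ hx (n := (⊤ : ℕ∞))
      have h2 : (N : ℝ) * ‖x‖ ^ N ≠ 0 := mul_ne_zero hN' (pow_ne_zero _ (norm_ne_zero_iff.2 hx))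
      exact ((hΨ.contDiffAt.comp x (h1.pow N)).div (contDiffAt_const.mul (h1.pow N)) h2).smul
        contDiffAt_id
  · exact HasCompactSupport.of_support_subset_isCompact (isCompact_closedBall 0 R')
      (subset_closure.trans hts)
  · exact hts.trans (Metric.closedBall_subset_ball hR')
  · intro x _
    rcases eq_or_ne x 0 with rfl | hx
    · simp [hφ]
    have hx' : 0 < ‖x‖ := norm_pos_iff.2 hx
    have hNpos : (0 : ℝ) < N := by positivity
    rw [hφ]
    simp only [hM]
    rw [norm_smul, Real.norm_eq_abs, abs_div, abs_of_pos (by positivity : 0 < (N : ℝ) * ‖x‖ ^ N),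
      div_mul_eq_mul_div, div_le_one (by positivity)]
    have := hle ‖x‖ hx'.le
    calc |Ψ (‖x‖ ^ N)| * ‖x‖ ≤ N * ‖x‖ ^ (N - 1) * ‖x‖ := by gcongr
      _ = N * ‖x‖ ^ N := by rw [mul_assoc, ← pow_succ, Nat.sub_add_cancel (by omega)]
  · intro x
    rcases eq_or_ne x 0 with rfl | hx
    · rw [divergence_congr hnear, divergence_smul_id]
      have h1 : Ψ =ᶠ[𝓝 0] fun s => κ * s := h0
      have h2 : HasDerivAt (fun s : ℝ => κ * s) κ 0 := by
        simpa using (hasDerivAt_id (0 : ℝ)).const_mul κ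
      rw [norm_zero, zero_pow hN, h1.deriv_eq, h2.deriv]
      field_simp
    · have hx' : 0 < ‖x‖ := norm_pos_iff.2 hx
      have h1 : HasDerivAt (fun r : ℝ => r ^ N) (N * ‖x‖ ^ (N - 1)) ‖x‖ := hasDerivAt_pow N _
      have h2 : HasDerivAt Ψ (deriv Ψ (‖x‖ ^ N)) (‖x‖ ^ N) :=
        (hΨ.differentiable (by simp)).differentiableAt.hasDerivAt
      have h5 : HasDerivAt (fun r => Ψ (r ^ N)) (deriv Ψ (‖x‖ ^ N) * (N * ‖x‖ ^ (N - 1))) ‖x‖ :=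
        h2.comp ‖x‖ h1
      have h3 : HasDerivAt M _ ‖x‖ := h5.div (h1.const_mul (N : ℝ)) (by positivity)
      rw [divergence_comp_norm_smul hx h3]
      simp only [hM]
      have h4 : ‖x‖ ^ (N - 1) = ‖x‖ ^ N / ‖x‖ := by
        rw [eq_div_iff hx'.ne', ← pow_succ, Nat.sub_add_cancel (by omega)]
      rw [h4]
      field_simp
      ring

end RadialCalculus

section Cutoff

/-- A smooth antitone cutoff, equal to `1` on `(-∞, 1 - 2δ]` and to `0` on `[1 - δ, ∞)`. -/
noncomputable def smoothCutoff (δ s : ℝ) : ℝ := Real.smoothTransition ((1 - δ - s) / δ)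

variable {δ : ℝ}

theorem contDiff_smoothCutoff : ContDiff ℝ (⊤ : ℕ∞) (smoothCutoff δ) :=
  Real.smoothTransition.contDiff.comp ((contDiff_const.sub contDiff_id).div_const δ)

theorem continuous_smoothCutoff : Continuous (smoothCutoff δ) := contDiff_smoothCutoff.continuous

theorem smoothCutoff_eq_one (hδ : 0 < δ) {s : ℝ} (hs : s ≤ 1 - 2 * δ) : smoothCutoff δ s = 1 :=
  Real.smoothTransition.one_of_one_le ((le_div_iff₀ hδ).2 (by linarith))

theorem smoothCutoff_eq_zero (hδ : 0 < δ) {s : ℝ} (hs : 1 - δ ≤ s) : smoothCutoff δ s = 0 :=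
  Real.smoothTransition.zero_of_nonpos (div_nonpos_of_nonpos_of_nonneg (by linarith) hδ.le)

theorem smoothCutoff_nonneg (s : ℝ) : 0 ≤ smoothCutoff δ s := Real.smoothTransition.nonneg _

theorem smoothCutoff_le_one (s : ℝ) : smoothCutoff δ s ≤ 1 := Real.smoothTransition.le_one _

theorem abs_smoothCutoff_le_one (s : ℝ) : |smoothCutoff δ s| ≤ 1 :=
  abs_le.2 ⟨by linarith [smoothCutoff_nonneg (δ := δ) s], smoothCutoff_le_one s⟩

theorem antitone_smoothCutoff (hδ : 0 < δ) : Antitone (smoothCutoff δ) := fun s t hst =>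
  Real.smoothTransition.monotone (div_le_div_of_nonneg_right (by linarith) hδ.le)

theorem tendsto_smoothCutoff {δ : ℕ → ℝ} (hδ : ∀ n, 0 < δ n) (hlim : Tendsto δ atTop (𝓝 0))
    (s : ℝ) : Tendsto (fun n => smoothCutoff (δ n) s) atTop (𝓝 (if s < 1 then 1 else 0)) := by
  refine tendsto_const_nhds.congr' ?_
  split_ifs with h
  · have : ∀ᶠ n in atTop, δ n < (1 - s) / 2 := hlim.eventually_lt_const (by linarith)
    filter_upwards [this] with n hn
    exact (smoothCutoff_eq_one (hδ n) (by linarith)).symm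
  · exact .of_forall fun n => (smoothCutoff_eq_zero (hδ n) (by linarith [hδ n])).symm

theorem exists_seq_pos_le_quarter_tendsto_zero :
    ∃ δ : ℕ → ℝ, (∀ n, 0 < δ n) ∧ (∀ n, δ n ≤ 1 / 4) ∧ Tendsto δ atTop (𝓝 0) := by
  refine ⟨fun n => 1 / ((n : ℝ) + 4), fun n => by positivity, fun n =>
    one_div_le_one_div_of_le (by norm_num) (by linarith [(Nat.cast_nonneg n : (0 : ℝ) ≤ n)]), ?_⟩
  simpa [Function.comp_def] using (tendsto_inv_atTop_zero.comp
    (tendsto_atTop_add_const_right _ (4 : ℝ) tendsto_natCast_atTop_atTop))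

/-- The primitive of `smoothCutoff δ`, a smooth approximation of `min s 1` for `0 ≤ s`. -/
noncomputable def smoothMinOne (δ s : ℝ) : ℝ := ∫ x in (0 : ℝ)..s, smoothCutoff δ x

theorem hasDerivAt_smoothMinOne (s : ℝ) : HasDerivAt (smoothMinOne δ) (smoothCutoff δ s) s :=
  intervalIntegral.integral_hasDerivAt_right (continuous_smoothCutoff.intervalIntegrable _ _)
    (continuous_smoothCutoff.stronglyMeasurableAtFilter _ _) continuous_smoothCutoff.continuousAt

theorem contDiff_smoothMinOne : ContDiff ℝ (⊤ : ℕ∞) (smoothMinOne δ) := by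
  rw [contDiff_infty_iff_deriv]
  refine ⟨fun s => (hasDerivAt_smoothMinOne s).differentiableAt, ?_⟩
  have : deriv (smoothMinOne δ) = smoothCutoff δ :=
    funext fun s => (hasDerivAt_smoothMinOne s).deriv
  rw [this]
  exact contDiff_smoothCutoff

theorem smoothMinOne_eq_self (hδ : 0 < δ) (hδ' : δ ≤ 1 / 2) {s : ℝ} (hs : s ≤ 1 - 2 * δ) :
    smoothMinOne δ s = s := by
  have : smoothMinOne δ s = ∫ _ in (0 : ℝ)..s, (1 : ℝ) := by
    refine intervalIntegral.integral_congr fun x hx => smoothCutoff_eq_one hδ ?_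
    rw [mem_uIcc] at hx
    rcases hx with hx | hx <;> linarith
  simp [this]

theorem smoothMinOne_eq_of_le (hδ : 0 < δ) {s : ℝ} (hs : 1 - δ ≤ s) :
    smoothMinOne δ s = smoothMinOne δ 1 := by
  have h1 : smoothMinOne δ s - smoothMinOne δ 1 = ∫ x in (1 : ℝ)..s, smoothCutoff δ x :=
    intervalIntegral.integral_interval_sub_left (continuous_smoothCutoff.intervalIntegrable _ _)
      (continuous_smoothCutoff.intervalIntegrable _ _)
  have h2 : ∫ x in (1 : ℝ)..s, smoothCutoff δ x = ∫ _ in (1 : ℝ)..s, (0 : ℝ) := by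
    refine intervalIntegral.integral_congr fun x hx => smoothCutoff_eq_zero hδ ?_
    rw [mem_uIcc] at hx
    rcases hx with hx | hx <;> linarith
  rw [h2] at h1
  simpa [sub_eq_zero] using h1

theorem monotone_smoothMinOne : Monotone (smoothMinOne δ) :=
  monotone_of_deriv_nonneg (contDiff_smoothMinOne.differentiable (by simp)) fun s => by
    rw [(hasDerivAt_smoothMinOne s).deriv]; exact smoothCutoff_nonneg s

theorem smoothMinOne_le_self {s : ℝ} (hs : 0 ≤ s) : smoothMinOne δ s ≤ s := by
  have : smoothMinOne δ s ≤ ∫ _ in (0 : ℝ)..s, (1 : ℝ) :=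
    intervalIntegral.integral_mono_on hs (continuous_smoothCutoff.intervalIntegrable _ _)
      (by simp) fun x _ => smoothCutoff_le_one x
  simpa using this

theorem abs_smoothMinOne_sub_min_le (hδ : 0 < δ) (hδ' : δ ≤ 1 / 2) {s : ℝ} (hs : 0 ≤ s) :
    |smoothMinOne δ s - min s 1| ≤ 2 * δ := by
  rcases le_total s (1 - 2 * δ) with h | h
  · rw [smoothMinOne_eq_self hδ hδ' h, min_eq_left (by linarith)]
    simp [hδ.le]
  · have h1 := monotone_smoothMinOne (δ := δ) h
    rw [smoothMinOne_eq_self hδ hδ' le_rfl] at h1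
    have h2 : smoothMinOne δ s ≤ min s 1 := by
      refine le_min (smoothMinOne_le_self hs) ?_
      rcases le_total s 1 with h3 | h3
      · exact (smoothMinOne_le_self hs).trans h3
      · rw [smoothMinOne_eq_of_le hδ (by linarith)]
        exact smoothMinOne_le_self zero_le_one
    rw [abs_le]
    constructor <;> linarith [min_le_right s 1]

end Cutoff

section TestFields

variable {N : ℕ} {Ω : Set (EuclideanSpace ℝ (Fin N))}
  {φ : EuclideanSpace ℝ (Fin N) → EuclideanSpace ℝ (Fin N)}

theorem neg_mem_testFields (hφ : φ ∈ testFields Ω) : -φ ∈ testFields Ω := by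
  obtain ⟨h1, h2, h3, h4⟩ := hφ
  refine ⟨h1.neg, h2.neg, ?_, fun x hx => by simpa using h4 x hx⟩
  rwa [tsupport_neg]

theorem divergence_neg (x : EuclideanSpace ℝ (Fin N)) : divergence (-φ) x = -divergence φ x := by
  simp [divergence, fderiv_neg]

theorem norm_le_one_of_mem_testFields (hφ : φ ∈ testFields Ω) (x : EuclideanSpace ℝ (Fin N)) :
    ‖φ x‖ ≤ 1 := by
  by_cases hx : x ∈ tsupport φ
  · exact hφ.2.2.2 x (hφ.2.2.1 hx)
  · simp [image_eq_zero_of_notMem_tsupport hx]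

theorem continuous_divergence (hφ : φ ∈ testFields Ω) : Continuous (divergence φ) := by
  have h1 : Continuous (fderiv ℝ φ) := hφ.1.continuous_fderiv (by simp)
  unfold divergence
  fun_prop

theorem hasCompactSupport_divergence (hφ : φ ∈ testFields Ω) :
    HasCompactSupport (divergence φ) := by
  refine (hφ.2.1.fderiv ℝ).mono fun x hx => ?_
  contrapose! hx
  rw [Function.notMem_support] at hx ⊢
  simp [divergence, hx]

theorem memLp_divergence (hφ : φ ∈ testFields Ω) (p : ℝ≥0∞) : MemLp (divergence φ) p :=
  (continuous_divergence hφ).memLp_of_hasCompactSupport (hasCompactSupport_divergence hφ)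

theorem integrable_divergence (hφ : φ ∈ testFields Ω) : Integrable (divergence φ) :=
  (continuous_divergence hφ).integrable_of_hasCompactSupport (hasCompactSupport_divergence hφ)

theorem divergence_eq_zero_of_notMem (hφ : φ ∈ testFields Ω) {x : EuclideanSpace ℝ (Fin N)}
    (hx : x ∉ Ω) : divergence φ x = 0 := by
  have h1 : φ =ᶠ[𝓝 x] 0 := notMem_tsupport_iff_eventuallyEq.1 fun h => hx (hφ.2.2.1 h)
  simp [divergence, h1.fderiv_eq]

/-- The divergence of a test field, as an element of `L²(Ω)`. -/
noncomputable def divergenceL2 (hφ : φ ∈ testFields Ω) : L2 Ω :=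
  ((memLp_divergence hφ 2).restrict Ω).toLp _

theorem setIntegral_mul_divergence_eq_inner (hφ : φ ∈ testFields Ω) (w : L2 Ω) :
    ∫ x in Ω, w x * divergence φ x = ⟪divergenceL2 hφ, w⟫ := by
  rw [L2.inner_def]
  refine integral_congr_ae ?_
  filter_upwards [((memLp_divergence hφ 2).restrict Ω).coeFn_toLp] with x hx
  rw [divergenceL2, hx]
  rfl

theorem inner_divergenceL2_le (hφ : φ ∈ testFields Ω) {w : L2 Ω}
    (hw : totalVariation Ω w < ∞) : ⟪divergenceL2 hφ, w⟫ ≤ (totalVariation Ω w).toReal := by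
  rw [← setIntegral_mul_divergence_eq_inner]
  refine (ENNReal.ofReal_le_iff_le_toReal hw.ne).1 ?_
  exact le_iSup₂ (f := fun φ _ => ENNReal.ofReal (∫ x in Ω, w x * divergence φ x)) φ hφ

theorem totalVariation_le_ofReal {w : L2 Ω} {C : ℝ}
    (h : ∀ φ (hφ : φ ∈ testFields Ω), ⟪divergenceL2 hφ, w⟫ ≤ C) :
    totalVariation Ω w ≤ ENNReal.ofReal C :=
  iSup₂_le fun φ hφ => ENNReal.ofReal_le_ofReal
    ((setIntegral_mul_divergence_eq_inner hφ w).trans_le (h φ hφ))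

theorem integral_mul_fderiv_eq_neg {η ψ : EuclideanSpace ℝ (Fin N) → ℝ} (hη : ContDiff ℝ 1 η)
    (hψ : ContDiff ℝ 1 ψ) (hc : HasCompactSupport ψ) (v : EuclideanSpace ℝ (Fin N)) :
    ∫ x, η x * fderiv ℝ ψ x v = -∫ x, fderiv ℝ η x v * ψ x := by
  have h1 : Continuous fun x => fderiv ℝ η x v :=
    (hη.continuous_fderiv (by simp)).clm_apply continuous_const
  have h2 : Continuous fun x => fderiv ℝ ψ x v :=
    (hψ.continuous_fderiv (by simp)).clm_apply continuous_const
  have h3 : Integrable fun x => fderiv ℝ η x v * ψ x :=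
    (h1.mul hψ.continuous).integrable_of_hasCompactSupport hc.mul_left
  have h4 : Integrable fun x => η x * fderiv ℝ ψ x v :=
    (hη.continuous.mul h2).integrable_of_hasCompactSupport (hc.fderiv_apply ℝ v).mul_left
  have h5 : Integrable fun x => η x * ψ x :=
    (hη.continuous.mul hψ.continuous).integrable_of_hasCompactSupport hc.mul_left
  exact integral_mul_fderiv_eq_neg_fderiv_mul_of_integrable h3 h4 h5
    (fun x _ => (hη.differentiable (by simp)).differentiableAt)
    (fun x _ => (hψ.differentiable (by simp)).differentiableAt)

theorem contDiff_apply_of_mem_testFields (hφ : φ ∈ testFields Ω) (i : Fin N) :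
    ContDiff ℝ (⊤ : ℕ∞) fun y => φ y i :=
  (EuclideanSpace.proj (𝕜 := ℝ) i).contDiff.comp hφ.1

theorem hasCompactSupport_apply_of_mem_testFields (hφ : φ ∈ testFields Ω) (i : Fin N) :
    HasCompactSupport fun y => φ y i :=
  hφ.2.1.comp_left (g := fun v : EuclideanSpace ℝ (Fin N) => v i) rfl

theorem divergence_eq_sum_fderiv_apply (hφ : φ ∈ testFields Ω) (x : EuclideanSpace ℝ (Fin N)) :
    divergence φ x = ∑ i, fderiv ℝ (fun y => φ y i) x (EuclideanSpace.single i 1) := by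
  refine Finset.sum_congr rfl fun i _ => ?_
  have h1 : HasFDerivAt φ (fderiv ℝ φ x) x :=
    (hφ.1.differentiable (by simp)).differentiableAt.hasFDerivAt
  have h2 : HasFDerivAt (fun y => φ y i)
      ((EuclideanSpace.proj (𝕜 := ℝ) i).comp (fderiv ℝ φ x)) x :=
    (EuclideanSpace.proj (𝕜 := ℝ) i).hasFDerivAt.comp x h1
  rw [h2.fderiv]
  rfl

/-- Integration by parts of the divergence against a scalar weight. -/
theorem integral_mul_divergence_eq_neg (hφ : φ ∈ testFields Ω)
    {η : EuclideanSpace ℝ (Fin N) → ℝ} (hη : ContDiff ℝ (⊤ : ℕ∞) η) :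
    ∫ x, η x * divergence φ x = -∫ x, fderiv ℝ η x (φ x) := by
  have hψ := fun i => (contDiff_apply_of_mem_testFields hφ i).of_le (m := 1) (by simp)
  have hc := hasCompactSupport_apply_of_mem_testFields hφ
  have hη1 : ContDiff ℝ 1 η := hη.of_le (by simp)
  have h1 : ∀ i, Integrable fun x =>
      η x * fderiv ℝ (fun y => φ y i) x (EuclideanSpace.single i 1) := fun i =>
    (hη1.continuous.mul (((hψ i).continuous_fderiv (by simp)).clm_apply
      continuous_const)).integrable_of_hasCompactSupport ((hc i).fderiv_apply ℝ _).mul_left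
  have h2 : ∀ i, Integrable fun x => fderiv ℝ η x (EuclideanSpace.single i 1) * φ x i := fun i =>
    (((hη1.continuous_fderiv (by simp)).clm_apply continuous_const).mul
      (hψ i).continuous).integrable_of_hasCompactSupport (hc i).mul_left
  have h3 : ∀ x, fderiv ℝ η x (φ x)
      = ∑ i, fderiv ℝ η x (EuclideanSpace.single i 1) * φ x i := by
    intro x
    have : φ x = ∑ i, φ x i • EuclideanSpace.single i (1 : ℝ) := by
      ext j; simp [Finset.sum_apply, Pi.single_apply]
    conv_lhs => rw [this, map_sum]
    simp [mul_comm]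
  simp only [divergence_eq_sum_fderiv_apply hφ, Finset.mul_sum, h3]
  rw [integral_finsetSum _ fun i _ => h1 i, integral_finsetSum _ fun i _ => h2 i,
    ← Finset.sum_neg_distrib]
  exact Finset.sum_congr rfl fun i _ => integral_mul_fderiv_eq_neg hη1 (hψ i) (hc i) _

theorem integral_divergence_eq_zero (hφ : φ ∈ testFields Ω) : ∫ x, divergence φ x = 0 := by
  simpa using integral_mul_divergence_eq_neg hφ (η := fun _ => 1) contDiff_const

theorem fderiv_comp_norm {f : ℝ → ℝ} (hf : ContDiff ℝ (⊤ : ℕ∞) f)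
    (h0 : ∀ᶠ s in 𝓝 (0 : ℝ), f s = f 0) (x : EuclideanSpace ℝ (Fin N)) :
    fderiv ℝ (fun y => f ‖y‖) x = (deriv f ‖x‖ * ‖x‖⁻¹) • innerSL ℝ x := by
  rcases eq_or_ne x 0 with rfl | hx
  · have h1 : Tendsto (fun x : EuclideanSpace ℝ (Fin N) => ‖x‖) (𝓝 0) (𝓝 0) :=
      tendsto_norm_zero
    have h2 : (fun y : EuclideanSpace ℝ (Fin N) => f ‖y‖) =ᶠ[𝓝 0] fun _ => f 0 := by
      filter_upwards [h1.eventually h0] with y hy using hy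
    rw [h2.fderiv_eq]; simp
  · exact (hasFDerivAt_comp_norm hx
      (hf.differentiable (by simp)).differentiableAt.hasDerivAt).fderiv

/-- The flux of a test field through a smoothed sphere of radius `ρ` is at most the area
`N ω_N ρ^(N-1)` of the sphere. -/
theorem integral_comp_norm_mul_divergence_le (hN : N ≠ 0) (hφ : φ ∈ testFields Ω) {f : ℝ → ℝ}
    (hf : ContDiff ℝ (⊤ : ℕ∞) f) (h0 : ∀ᶠ s in 𝓝 (0 : ℝ), f s = f 0)
    (hanti : AntitoneOn f (Ioi 0)) {ρ : ℝ} (hρ : 0 ≤ ρ) (hsupp : ∀ s, ρ ≤ s → f s = 0) :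
    ∫ x, f ‖x‖ * divergence φ x ≤
      N * volume.real (Metric.ball (0 : EuclideanSpace ℝ (Fin N)) 1) * ρ ^ (N - 1) * f 0 := by
  have : Nonempty (Fin N) := Fin.pos_iff_nonempty.1 (Nat.pos_of_ne_zero hN)
  have hd : ∀ s, ρ < s → deriv f s = 0 := by
    intro s hs
    have : f =ᶠ[𝓝 s] fun _ => 0 := by
      filter_upwards [Ioi_mem_nhds hs] with y hy using hsupp y (le_of_lt hy)
    rw [this.deriv_eq]; simp
  have hdc : Continuous (deriv f) := hf.continuous_deriv (by simp)
  have hdneg : ∀ s, 0 < s → deriv f s ≤ 0 := by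
    intro s hs
    rw [← derivWithin_of_mem_nhds (Ioi_mem_nhds hs)]
    exact hanti.derivWithin_nonpos
  have hint : IntegrableOn (fun s => s ^ (N - 1) * |deriv f s|) (Ioi 0) := by
    have h1 : IntegrableOn (fun s => s ^ (N - 1) * |deriv f s|) (Icc 0 ρ) :=
      (by fun_prop : Continuous fun s => s ^ (N - 1) * |deriv f s|).integrableOn_Icc
    refine (h1.of_forall_sdiff_eq_zero measurableSet_Ioi fun s hs => ?_)
    have : ρ < s := by
      by_contra! h
      exact hs.2 ⟨le_of_lt hs.1, h⟩
    simp [hd s this]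
  rw [integral_mul_divergence_eq_neg hφ (contDiff_comp_norm hf h0), ← integral_neg]
  have hle : ∫ x, -fderiv ℝ (fun y => f ‖y‖) x (φ x)
      ≤ ∫ x : EuclideanSpace ℝ (Fin N), |deriv f ‖x‖| := by
    refine integral_mono ?_ ((integrable_fun_norm_addHaar volume (f := fun s => |deriv f s|)).2 ?_)
      fun x => ?_
    · have h1 : Continuous (fderiv ℝ fun y : EuclideanSpace ℝ (Fin N) => f ‖y‖) :=
        (contDiff_comp_norm hf h0).continuous_fderiv (by simp)
      refine ((h1.clm_apply hφ.1.continuous).integrable_of_hasCompactSupport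
        (hφ.2.1.mono fun x hx => ?_)).neg
      contrapose! hx
      rw [Function.notMem_support] at hx ⊢
      simp [hx]
    · simpa using hint
    · refine (neg_le_abs _).trans ?_
      rw [fderiv_comp_norm hf h0]
      simp only [smul_apply, innerSL_apply_apply, smul_eq_mul, abs_mul,
        abs_inv, abs_norm]
      have h1 : |⟪x, φ x⟫| ≤ ‖x‖ * 1 := (abs_real_inner_le_norm _ _).trans
        (mul_le_mul_of_nonneg_left (norm_le_one_of_mem_testFields hφ x) (norm_nonneg _))
      rw [mul_one] at h1
      rcases eq_or_ne x 0 with rfl | hx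
      · simp
      · have h2 : 0 < ‖x‖ := norm_pos_iff.2 hx
        calc |deriv f ‖x‖| * ‖x‖⁻¹ * |⟪x, φ x⟫| ≤ |deriv f ‖x‖| * ‖x‖⁻¹ * ‖x‖ := by gcongr
          _ = |deriv f ‖x‖| := by field_simp
  refine hle.trans ?_
  rw [integral_fun_norm_addHaar volume (fun s => |deriv f s|)]
  simp only [finrank_euclideanSpace, Fintype.card_fin, smul_eq_mul, nsmul_eq_mul]
  have hkey : ∫ s in Ioi (0 : ℝ), s ^ (N - 1) * |deriv f s| ≤ ρ ^ (N - 1) * f 0 := by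
    have h1 : ∫ s in Ioi (0 : ℝ), s ^ (N - 1) * |deriv f s|
        = ∫ s in Ioc 0 ρ, s ^ (N - 1) * |deriv f s| :=
      setIntegral_eq_of_subset_of_forall_sdiff_eq_zero measurableSet_Ioi
        (fun s hs => hs.1) fun s hs => by
          have : ρ < s := by
            by_contra! h
            exact hs.2 ⟨hs.1, h⟩
          simp [hd s this]
    have h2 : ∫ s in Ioc 0 ρ, s ^ (N - 1) * |deriv f s|
        ≤ ∫ s in Ioc 0 ρ, ρ ^ (N - 1) * -deriv f s := by
      refine setIntegral_mono_on (hint.mono_set fun s hs => hs.1) ?_ measurableSet_Ioc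
        fun s hs => ?_
      · exact ((by fun_prop : Continuous fun s => ρ ^ (N - 1) * -deriv f s).integrableOn_Icc
          (a := 0) (b := ρ)).mono_set Ioc_subset_Icc_self
      · rw [abs_of_nonpos (hdneg s hs.1)]
        exact mul_le_mul_of_nonneg_right (pow_le_pow_left₀ hs.1.le hs.2 _)
          (by linarith [hdneg s hs.1])
    have h3 : ∫ s in Ioc 0 ρ, ρ ^ (N - 1) * -deriv f s = ρ ^ (N - 1) * f 0 := by
      rw [← intervalIntegral.integral_of_le hρ, intervalIntegral.integral_const_mul,
        intervalIntegral.integral_neg, intervalIntegral.integral_deriv_eq_sub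
          (fun x _ => (hf.differentiable (by simp)).differentiableAt)
          (hdc.intervalIntegrable _ _), hsupp ρ le_rfl]
      ring
    linarith
  calc _ ≤ (N : ℝ) * (volume.real (Metric.ball (0 : EuclideanSpace ℝ (Fin N)) 1)
        * (ρ ^ (N - 1) * f 0)) := by gcongr
    _ = _ := by ring

/-- The flux of a test field through the sphere of radius `ρ` is at most its area. -/
theorem setIntegral_ball_divergence_le (hN : N ≠ 0) (hφ : φ ∈ testFields Ω) {ρ : ℝ}
    (hρ : 0 < ρ) : ∫ x in Metric.ball 0 ρ, divergence φ x ≤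
      N * volume.real (Metric.ball (0 : EuclideanSpace ℝ (Fin N)) 1) * ρ ^ (N - 1) := by
  obtain ⟨δ, hδpos, hδle, hδlim⟩ := exists_seq_pos_le_quarter_tendsto_zero
  have hlim : Tendsto (fun n => ∫ x, smoothCutoff (δ n) (‖x‖ ^ N / ρ ^ N) * divergence φ x) atTop
      (𝓝 (∫ x, (if ‖x‖ ^ N / ρ ^ N < 1 then 1 else 0) * divergence φ x)) := by
    refine tendsto_integral_of_dominated_convergence (fun x => ‖divergence φ x‖) (fun n => ?_)
      (integrable_divergence hφ).norm (fun n => .of_forall fun x => ?_)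
      (.of_forall fun x => (tendsto_smoothCutoff hδpos hδlim _).mul_const _)
    · have h1 := continuous_smoothCutoff (δ := δ n)
      have h2 := continuous_divergence hφ
      exact Continuous.aestronglyMeasurable (by fun_prop)
    · rw [norm_mul, Real.norm_eq_abs]
      exact mul_le_of_le_one_left (norm_nonneg _) (abs_smoothCutoff_le_one _)
  have heq : ∫ x in Metric.ball 0 ρ, divergence φ x
      = ∫ x, (if ‖x‖ ^ N / ρ ^ N < 1 then 1 else 0) * divergence φ x := by
    rw [← integral_indicator Metric.isOpen_ball.measurableSet]
    congr 1
    ext x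
    have : ‖x‖ ^ N / ρ ^ N < 1 ↔ x ∈ Metric.ball (0 : EuclideanSpace ℝ (Fin N)) ρ := by
      rw [div_lt_one (by positivity), mem_ball_zero_iff,
        pow_lt_pow_iff_left₀ (norm_nonneg _) hρ.le hN]
    by_cases hx : x ∈ Metric.ball (0 : EuclideanSpace ℝ (Fin N)) ρ
    · rw [if_pos (this.2 hx), indicator_of_mem hx, one_mul]
    · rw [if_neg (this.not.2 hx), indicator_of_notMem hx, zero_mul]
  rw [heq]
  refine le_of_tendsto hlim (.of_forall fun n => ?_)
  have hpow : Tendsto (fun s : ℝ => s ^ N / ρ ^ N) (𝓝 0) (𝓝 0) := by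
    have : Continuous fun s : ℝ => s ^ N / ρ ^ N := by fun_prop
    simpa [hN] using this.tendsto 0
  have h1 := integral_comp_norm_mul_divergence_le hN hφ
    (f := fun s => smoothCutoff (δ n) (s ^ N / ρ ^ N))
    (contDiff_smoothCutoff.comp ((contDiff_id.pow N).div_const _)) ?_ ?_ hρ.le ?_
  · simpa [hN, smoothCutoff_eq_one (hδpos n) (s := 0) (by linarith [hδle n])] using h1
  · filter_upwards [hpow.eventually_lt_const (by norm_num : (0 : ℝ) < 1 / 2)] with s hs
    rw [smoothCutoff_eq_one (hδpos n) (by linarith [hδle n]),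
      smoothCutoff_eq_one (hδpos n) (by simp [hN]; linarith [hδle n])]
  · intro s hs t _ hst
    refine antitone_smoothCutoff (hδpos n) ?_
    have := pow_le_pow_left₀ (le_of_lt hs) hst N
    gcongr
  · intro s hs
    refine smoothCutoff_eq_zero (hδpos n) ?_
    have h2 : 1 ≤ s ^ N / ρ ^ N :=
      (one_le_div (by positivity)).2 (pow_le_pow_left₀ hρ.le hs N)
    linarith [hδpos n]

theorem abs_setIntegral_ball_divergence_le (hN : N ≠ 0) (hφ : φ ∈ testFields Ω) {ρ : ℝ}
    (hρ : 0 < ρ) : |∫ x in Metric.ball 0 ρ, divergence φ x| ≤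
      N * volume.real (Metric.ball (0 : EuclideanSpace ℝ (Fin N)) 1) * ρ ^ (N - 1) := by
  refine abs_le'.2 ⟨setIntegral_ball_divergence_le hN hφ hρ, ?_⟩
  have := setIntegral_ball_divergence_le hN (neg_mem_testFields hφ) hρ
  simpa only [divergence_neg, integral_neg] using this

end TestFields

section BallIndicators

variable {N : ℕ} {R : ℝ}

/-- The indicator of the ball of radius `ρ`, as an element of `L²(B(0, R))`. -/
noncomputable def ballL2 (N : ℕ) (R ρ : ℝ) : L2 (Metric.ball (0 : EuclideanSpace ℝ (Fin N)) R) :=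
  indicatorConstLp 2 (s := Metric.ball 0 ρ) Metric.isOpen_ball.measurableSet
    ((Measure.restrict_apply_le _ _).trans_lt measure_ball_lt_top).ne (1 : ℝ)

theorem ballL2_zero : ballL2 N R 0 = 0 := by
  simp [ballL2]

theorem inner_ballL2_left {ρ : ℝ} (hρ : ρ ≤ R)
    (w : L2 (Metric.ball (0 : EuclideanSpace ℝ (Fin N)) R)) :
    ⟪ballL2 N R ρ, w⟫ = ∫ x in Metric.ball 0 ρ, w x := by
  rw [ballL2, L2.inner_indicatorConstLp_one,
    Measure.restrict_restrict Metric.isOpen_ball.measurableSet,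
    inter_eq_left.2 (Metric.ball_subset_ball hρ)]

theorem volume_real_ball {ρ : ℝ} (hρ : 0 ≤ ρ) (hN : N ≠ 0) :
    volume.real (Metric.ball (0 : EuclideanSpace ℝ (Fin N)) ρ)
      = volume.real (Metric.ball (0 : EuclideanSpace ℝ (Fin N)) 1) * ρ ^ N := by
  have : Nonempty (Fin N) := Fin.pos_iff_nonempty.1 (Nat.pos_of_ne_zero hN)
  rw [Measure.real, Measure.addHaar_ball _ _ hρ, ENNReal.toReal_mul,
    ENNReal.toReal_ofReal (by positivity), finrank_euclideanSpace, Fintype.card_fin, mul_comm]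
  rfl

theorem inner_ballL2_ballL2 (hN : N ≠ 0) {ρ ρ' : ℝ} (hρ : 0 ≤ ρ) (hρ' : 0 ≤ ρ') (h : ρ ≤ R)
    (h' : ρ' ≤ R) : ⟪ballL2 N R ρ, ballL2 N R ρ'⟫
      = volume.real (Metric.ball (0 : EuclideanSpace ℝ (Fin N)) 1) * min (ρ ^ N) (ρ' ^ N) := by
  wlog hle : ρ ≤ ρ' generalizing ρ ρ'
  · rw [real_inner_comm, min_comm]
    exact this hρ' hρ h' h (le_of_not_ge hle)
  have hae : ∀ᵐ x ∂(volume.restrict (Metric.ball (0 : EuclideanSpace ℝ (Fin N)) ρ)),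
      ballL2 N R ρ' x = 1 := by
    have h1 : ⇑(ballL2 N R ρ') =ᵐ[volume.restrict (Metric.ball 0 R)]
      (Metric.ball 0 ρ').indicator fun _ => (1 : ℝ) := indicatorConstLp_coeFn
    filter_upwards [ae_restrict_of_ae_restrict_of_subset (Metric.ball_subset_ball h) h1,
      ae_restrict_mem Metric.isOpen_ball.measurableSet] with x hx hmem
    rw [hx, indicator_of_mem (Metric.ball_subset_ball hle hmem)]
  rw [inner_ballL2_left h, integral_congr_ae hae, min_eq_left (pow_le_pow_left₀ hρ hle N),
    ← volume_real_ball hρ hN]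
  simp

theorem inner_ballL2_divergenceL2 {φ : EuclideanSpace ℝ (Fin N) → EuclideanSpace ℝ (Fin N)}
    (hφ : φ ∈ testFields (Metric.ball (0 : EuclideanSpace ℝ (Fin N)) R)) {ρ : ℝ} (hρ : ρ ≤ R) :
    ⟪ballL2 N R ρ, divergenceL2 hφ⟫ = ∫ x in Metric.ball 0 ρ, divergence φ x := by
  rw [inner_ballL2_left hρ]
  refine integral_congr_ae ?_
  exact ae_restrict_of_ae_restrict_of_subset (Metric.ball_subset_ball hρ)
    ((memLp_divergence hφ 2).restrict _).coeFn_toLp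

theorem abs_inner_ballL2_divergenceL2_le (hN : N ≠ 0)
    {φ : EuclideanSpace ℝ (Fin N) → EuclideanSpace ℝ (Fin N)}
    (hφ : φ ∈ testFields (Metric.ball (0 : EuclideanSpace ℝ (Fin N)) R)) {ρ : ℝ} (hρ0 : 0 < ρ)
    (hρ : ρ ≤ R) : |⟪ballL2 N R ρ, divergenceL2 hφ⟫|
      ≤ N * volume.real (Metric.ball (0 : EuclideanSpace ℝ (Fin N)) 1) * ρ ^ (N - 1) := by
  rw [inner_ballL2_divergenceL2 hφ hρ]
  exact abs_setIntegral_ball_divergence_le hN hφ hρ0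

theorem inner_ballL2_self_divergenceL2
    {φ : EuclideanSpace ℝ (Fin N) → EuclideanSpace ℝ (Fin N)}
    (hφ : φ ∈ testFields (Metric.ball (0 : EuclideanSpace ℝ (Fin N)) R)) :
    ⟪ballL2 N R R, divergenceL2 hφ⟫ = 0 := by
  rw [inner_ballL2_divergenceL2 hφ le_rfl, ← integral_divergence_eq_zero hφ]
  exact setIntegral_eq_integral_of_forall_compl_eq_zero fun x hx =>
    divergence_eq_zero_of_notMem hφ hx

/-- A radial step function `∑ aⱼ 1_{B(0, ρⱼ)}` whose flux through every sphere centred at `0` is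
at most the area of the sphere, and vanishes on the boundary, is a subgradient of the total
variation at `0`. -/
theorem inner_sum_smul_ballL2_le (hN : N ≠ 0) {ι : Type*} [Fintype ι] {ρ a : ι → ℝ} {μ : ℝ}
    (hμ : 0 < μ) (hμρ : ∀ j, μ ≤ ρ j) (hρR : ∀ j, ρ j ≤ R) (hR : 0 < R)
    (hsum : ∑ j, a j * ρ j ^ N = 0)
    (hle : ∀ r ∈ Icc 0 R, |∑ j, a j * min (r ^ N) (ρ j ^ N)| ≤ N * r ^ (N - 1))
    {w : L2 (Metric.ball (0 : EuclideanSpace ℝ (Fin N)) R)}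
    (hw : totalVariation (Metric.ball 0 R) w < ∞) :
    ⟪∑ j, a j • ballL2 N R (ρ j), w⟫ ≤ (totalVariation (Metric.ball 0 R) w).toReal := by
  have hN1 : (1 : ℝ) ≤ N := by exact_mod_cast Nat.one_le_iff_ne_zero.2 hN
  have hρ : ∀ j, 0 < ρ j := fun j => hμ.trans_le (hμρ j)
  set A : ℝ := ∑ j, |a j| * ρ j ^ N with hA
  have hA0 : 0 ≤ A := Finset.sum_nonneg fun j _ => mul_nonneg (abs_nonneg _) (pow_nonneg (hρ j).le _)
  set C : ℝ := 2 * A / (μ / 2) ^ (N - 1) with hC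
  have hC0 : 0 ≤ C := by positivity
  have hmain : ∀ δ : ℝ, 0 < δ → δ ≤ 1 / 4 →
      ∫ x in Metric.ball 0 R, w x * ∑ j, a j * smoothCutoff δ (‖x‖ ^ N / ρ j ^ N)
        ≤ (1 + C * δ) * (totalVariation (Metric.ball 0 R) w).toReal := by
    intro δ hδ hδ4
    set K : ℝ := 1 + C * δ with hK
    have hK1 : 1 ≤ K := by rw [hK]; nlinarith [mul_nonneg hC0 hδ.le]
    set Ψ : ℝ → ℝ := fun s => K⁻¹ * ∑ j, a j * ρ j ^ N * smoothMinOne δ (s / ρ j ^ N) with hΨ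
    have hlin : ∀ s, s ≤ μ ^ N / 2 → ∀ j, smoothMinOne δ (s / ρ j ^ N) = s / ρ j ^ N := by
      intro s hs j
      refine smoothMinOne_eq_self hδ (by linarith) ?_
      have h1 : μ ^ N ≤ ρ j ^ N := pow_le_pow_left₀ hμ.le (hμρ j) N
      rw [div_le_iff₀ (pow_pos (hρ j) N)]
      nlinarith [pow_pos hμ N, pow_pos (hρ j) N]
    have hout : ∀ r, R * (1 - δ / N) ≤ r → ∑ j, a j * ρ j ^ N * smoothMinOne δ (r ^ N / ρ j ^ N)
        = 0 := by
      intro r hr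
      have h1 : ∀ j, smoothMinOne δ (r ^ N / ρ j ^ N) = smoothMinOne δ 1 := by
        intro j
        refine smoothMinOne_eq_of_le hδ ((le_div_iff₀ (pow_pos (hρ j) N)).2 ?_)
        have hδN : δ / N ≤ δ := div_le_self hδ.le hN1
        have h2 : 1 - δ ≤ (1 - δ / N) ^ N := by
          have := one_add_mul_le_pow (a := -(δ / N)) (by linarith) N
          have h3 : (N : ℝ) * -(δ / N) = -δ := by field_simp
          rw [h3] at this
          simpa [sub_eq_add_neg] using this
        calc (1 - δ) * ρ j ^ N ≤ (1 - δ / N) ^ N * R ^ N := by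
              have := hρR j
              have := (hρ j).le
              have : (0 : ℝ) ≤ 1 - δ / N := by linarith
              gcongr
          _ = (R * (1 - δ / N)) ^ N := by rw [mul_pow, mul_comm]
          _ ≤ r ^ N := pow_le_pow_left₀ (mul_nonneg hR.le (by linarith)) hr N
      simp only [h1, ← Finset.sum_mul, hsum, zero_mul]
    obtain ⟨φ, hφ, hdiv⟩ := exists_testField_divergence_eq hN (R := R) (R' := R * (1 - δ / N))
      (κ := K⁻¹ * ∑ j, a j) (Ψ := Ψ) (by
        have : 0 < R * (δ / N) := by positivity
        linarith) (by
        have := contDiff_smoothMinOne (δ := δ)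
        refine contDiff_const.mul (ContDiff.sum fun j _ => contDiff_const.mul ?_)
        exact this.comp (contDiff_id.div_const _)) (by
        have : 0 < μ ^ N / 2 := by positivity
        filter_upwards [Iio_mem_nhds this] with s hs
        simp only [hΨ, hlin s (le_of_lt hs)]
        rw [mul_assoc, Finset.sum_mul]
        congr 1
        refine Finset.sum_congr rfl fun j _ => ?_
        have := pow_pos (hρ j) N
        field_simp) (by
        intro r hr
        simp only [hΨ, hout r hr, mul_zero]) (by
        intro r hr
        simp only [hΨ]
        rw [abs_mul, abs_of_pos (by positivity : 0 < K⁻¹), inv_mul_le_iff₀ (by positivity)]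
        rcases le_or_gt r R with hrR | hrR
        swap
        · rw [hout r (by
            have : 0 < R * (δ / N) := by positivity
            linarith)]
          simp only [abs_zero]
          positivity
        have hmin : ∀ j, min (r ^ N) (ρ j ^ N) = ρ j ^ N * min (r ^ N / ρ j ^ N) 1 := by
          intro j
          have := pow_pos (hρ j) N
          rw [mul_min_of_nonneg _ _ this.le, mul_one, mul_div_cancel₀ _ this.ne']
        have hle' := hle r ⟨hr, hrR⟩
        rcases le_total (r ^ N) (μ ^ N / 2) with hsmall | hbig
        · have heq : ∑ j, a j * ρ j ^ N * smoothMinOne δ (r ^ N / ρ j ^ N)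
              = ∑ j, a j * min (r ^ N) (ρ j ^ N) := by
            refine Finset.sum_congr rfl fun j _ => ?_
            have h1 := pow_pos (hρ j) N
            have h2 : μ ^ N ≤ ρ j ^ N := pow_le_pow_left₀ hμ.le (hμρ j) N
            rw [hlin _ hsmall j, min_eq_left (by linarith [pow_pos hμ N])]
            field_simp
          rw [heq]
          refine hle'.trans (le_mul_of_one_le_left (by positivity) hK1)
        · have herr : |∑ j, a j * ρ j ^ N * smoothMinOne δ (r ^ N / ρ j ^ N)
              - ∑ j, a j * min (r ^ N) (ρ j ^ N)| ≤ A * (2 * δ) := by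
            rw [← Finset.sum_sub_distrib, hA, Finset.sum_mul]
            refine (Finset.abs_sum_le_sum_abs _ _).trans (Finset.sum_le_sum fun j _ => ?_)
            have h1 := pow_pos (hρ j) N
            rw [hmin j, ← mul_assoc, ← mul_sub, abs_mul, abs_mul, abs_of_pos h1]
            exact mul_le_mul_of_nonneg_left
              (abs_smoothMinOne_sub_min_le hδ (by linarith) (by positivity)) (by positivity)
          have hr2 : μ / 2 ≤ r := by
            by_contra! h
            have h1 : r ^ N < (μ / 2) ^ N := pow_lt_pow_left₀ h hr hN
            have h2 : (μ / 2) ^ N ≤ μ ^ N / 2 := by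
              rw [div_pow]
              have : (2 : ℝ) ≤ 2 ^ N := le_self_pow₀ (by norm_num) hN
              gcongr
            linarith
          have h3 : A * (2 * δ) ≤ C * δ * (N * r ^ (N - 1)) := by
            have h4 : (μ / 2) ^ (N - 1) ≤ r ^ (N - 1) := pow_le_pow_left₀ (by positivity) hr2 _
            have h5 : A * (2 * δ) = C * δ * (μ / 2) ^ (N - 1) := by
              rw [hC]; field_simp
            rw [h5]
            refine mul_le_mul_of_nonneg_left ?_ (by positivity)
            have : (0 : ℝ) ≤ r ^ (N - 1) := by positivity
            nlinarith
          have h6 := abs_sub_abs_le_abs_sub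
            (∑ j, a j * ρ j ^ N * smoothMinOne δ (r ^ N / ρ j ^ N))
            (∑ j, a j * min (r ^ N) (ρ j ^ N))
          rw [hK, add_mul, one_mul]
          linarith)
    have h1 := inner_divergenceL2_le hφ hw
    rw [← setIntegral_mul_divergence_eq_inner] at h1
    have h2 : ∀ x, divergence φ x
        = K⁻¹ * ∑ j, a j * smoothCutoff δ (‖x‖ ^ N / ρ j ^ N) := by
      intro x
      rw [hdiv]
      have h3 : HasDerivAt Ψ (K⁻¹ * ∑ j, a j * ρ j ^ N *
          (smoothCutoff δ (‖x‖ ^ N / ρ j ^ N) * (1 / ρ j ^ N))) (‖x‖ ^ N) := by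
        refine HasDerivAt.const_mul _ (HasDerivAt.fun_sum fun j _ => HasDerivAt.const_mul _ ?_)
        exact (hasDerivAt_smoothMinOne (δ := δ) (‖x‖ ^ N / ρ j ^ N)).comp (‖x‖ ^ N)
          ((hasDerivAt_id (‖x‖ ^ N)).div_const _)
      rw [h3.deriv]
      congr 1
      refine Finset.sum_congr rfl fun j _ => ?_
      have := pow_pos (hρ j) N
      field_simp
    have h4 : ∫ x in Metric.ball 0 R, w x * divergence φ x = K⁻¹ *
        ∫ x in Metric.ball 0 R, w x * ∑ j, a j * smoothCutoff δ (‖x‖ ^ N / ρ j ^ N) := by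
      rw [← integral_const_mul]
      congr 1
      ext x
      rw [h2]; ring
    rwa [h4, inv_mul_le_iff₀ (by positivity)] at h1
  obtain ⟨δ, hδpos, hδle, hδlim⟩ := exists_seq_pos_le_quarter_tendsto_zero
  have hlim : Tendsto (fun n => ∫ x in Metric.ball 0 R,
      w x * ∑ j, a j * smoothCutoff (δ n) (‖x‖ ^ N / ρ j ^ N)) atTop
      (𝓝 (∫ x in Metric.ball 0 R,
        w x * ∑ j, a j * (if ‖x‖ ^ N / ρ j ^ N < 1 then 1 else 0))) := by
    have hwm : AEStronglyMeasurable w (volume.restrict (Metric.ball 0 R)) :=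
      Lp.aestronglyMeasurable w
    refine tendsto_integral_of_dominated_convergence (fun x => ‖w x‖ * ∑ j, |a j|) (fun n => ?_)
      ?_ (fun n => .of_forall fun x => ?_) (.of_forall fun x => ?_)
    · refine hwm.mul (Continuous.aestronglyMeasurable ?_)
      have := continuous_smoothCutoff (δ := δ n)
      fun_prop
    · have : IsFiniteMeasure (volume.restrict (Metric.ball (0 : EuclideanSpace ℝ (Fin N)) R)) :=
        ⟨by simpa using measure_ball_lt_top⟩
      exact ((Lp.memLp w).integrable (by norm_num)).norm.mul_const _
    · rw [norm_mul]
      refine mul_le_mul_of_nonneg_left ((norm_sum_le _ _).trans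
        (Finset.sum_le_sum fun j _ => ?_)) (norm_nonneg _)
      rw [norm_mul, Real.norm_eq_abs, Real.norm_eq_abs]
      exact mul_le_of_le_one_right (abs_nonneg _) (abs_smoothCutoff_le_one _)
    · exact (tendsto_finsetSum _ fun j _ =>
        (tendsto_smoothCutoff hδpos hδlim _).const_mul _).const_mul _
  have hlim2 : Tendsto (fun n => (1 + C * δ n) * (totalVariation (Metric.ball 0 R) w).toReal) atTop
      (𝓝 ((1 + C * 0) * (totalVariation (Metric.ball 0 R) w).toReal)) :=
    ((hδlim.const_mul C).const_add 1).mul_const _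
  have hfin := le_of_tendsto_of_tendsto' hlim hlim2 fun n => hmain (δ n) (hδpos n) (hδle n)
  rw [mul_zero, add_zero, one_mul] at hfin
  refine le_trans (le_of_eq ?_) hfin
  rw [L2.inner_def]
  refine integral_congr_ae ?_
  have hind : ∀ j, ⇑(ballL2 N R (ρ j)) =ᵐ[volume.restrict (Metric.ball 0 R)]
      (Metric.ball 0 (ρ j)).indicator fun _ => (1 : ℝ) := fun j => indicatorConstLp_coeFn
  have hcoe : ⇑(∑ j, a j • ballL2 N R (ρ j)) =ᵐ[volume.restrict (Metric.ball 0 R)]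
      fun x => ∑ j, a j * ballL2 N R (ρ j) x := by
    refine (Lp.coeFn_finsetSum _ _).trans ?_
    have : ∀ j, ⇑(a j • ballL2 N R (ρ j)) =ᵐ[volume.restrict (Metric.ball 0 R)]
      fun x => a j * ballL2 N R (ρ j) x := fun j => Lp.coeFn_smul _ _
    filter_upwards [ae_all_iff.2 this] with x hx
    simp [Finset.sum_apply, hx]
  filter_upwards [hcoe, ae_all_iff.2 hind] with x hx1 hx2
  rw [hx1]
  simp only [hx2, RCLike.inner_apply, conj_trivial]
  congr 1
  refine Finset.sum_congr rfl fun j _ => ?_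
  have : ‖x‖ ^ N / ρ j ^ N < 1 ↔ x ∈ Metric.ball (0 : EuclideanSpace ℝ (Fin N)) (ρ j) := by
    rw [div_lt_one (pow_pos (hρ j) N), mem_ball_zero_iff,
      pow_lt_pow_iff_left₀ (norm_nonneg _) (hρ j).le hN]
  by_cases hx : x ∈ Metric.ball (0 : EuclideanSpace ℝ (Fin N)) (ρ j)
  · rw [if_pos (this.2 hx), indicator_of_mem hx]
  · rw [if_neg (this.not.2 hx), indicator_of_notMem hx]

end BallIndicators

section Mesh

theorem rpow_pow_eq_pow_pred {N : ℕ} (hN : N ≠ 0) {x : ℝ} (hx : 0 ≤ x) :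
    (x ^ N) ^ (((N - 1 : ℕ) : ℝ) / N) = x ^ (N - 1) := by
  rw [← Real.rpow_natCast x N, ← Real.rpow_mul hx, mul_div_cancel₀ _ (Nat.cast_ne_zero.2 hN),
    Real.rpow_natCast]

theorem concaveOn_rpow_pred_div (N : ℕ) :
    ConcaveOn ℝ (Ici 0) fun x : ℝ => x ^ (((N - 1 : ℕ) : ℝ) / N) :=
  Real.concaveOn_rpow (by positivity) (div_le_one_of_le₀ (by exact_mod_cast Nat.sub_le N 1)
    (Nat.cast_nonneg N))

/-- `r^(N-1)` is a concave function of `r^N`. -/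
theorem pow_pred_slope_anti {N : ℕ} (hN : N ≠ 0) {x y z : ℝ} (hx : 0 ≤ x) (hxy : x < y)
    (hyz : y < z) : (z ^ (N - 1) - y ^ (N - 1)) / (z ^ N - y ^ N)
      ≤ (y ^ (N - 1) - x ^ (N - 1)) / (y ^ N - x ^ N) := by
  have hy := hx.trans hxy.le
  have hz := hy.trans hyz.le
  have := (concaveOn_rpow_pred_div N).slope_anti_adjacent (mem_Ici.2 (pow_nonneg hx N))
    (mem_Ici.2 (pow_nonneg hz N)) (pow_lt_pow_left₀ hxy hx hN) (pow_lt_pow_left₀ hyz hy hN)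
  simpa only [rpow_pow_eq_pow_pred hN hx, rpow_pow_eq_pow_pred hN hy,
    rpow_pow_eq_pow_pred hN hz] using this

variable {N m : ℕ} {R : ℝ}

theorem mesh_nonneg (hR : 0 < R) (k : ℕ) : 0 ≤ R * k / m := by positivity

theorem mesh_lt (hR : 0 < R) (hm : 0 < m) {k l : ℕ} (h : k < l) : R * k / m < R * l / m := by
  have : (k : ℝ) < l := by exact_mod_cast h
  gcongr

theorem mesh_le (hR : 0 < R) {k l : ℕ} (h : k ≤ l) : R * k / m ≤ R * l / m := by
  have : (k : ℝ) ≤ l := by exact_mod_cast h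
  gcongr

theorem mesh_self (hm : 0 < m) : R * m / m = R := by
  field_simp

theorem mesh_le_radius (hR : 0 < R) (hm : 0 < m) {k : ℕ} (h : k ≤ m) : R * k / m ≤ R :=
  (mesh_le hR h).trans_eq (mesh_self hm)

theorem exists_mesh_mem_Icc (hR : 0 < R) (hm : 0 < m) {r : ℝ} (hr : r ∈ Icc 0 R) :
    ∃ k < m, r ∈ Icc (R * k / m) (R * (k + 1 : ℕ) / m) := by
  have hm' : (0 : ℝ) < m := by exact_mod_cast hm
  rcases hr.2.eq_or_lt with rfl | hlt
  · refine ⟨m - 1, by omega, ?_, ?_⟩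
    · exact mesh_le_radius hR hm (by omega)
    · rw [Nat.sub_add_cancel hm, mesh_self hm]
  · have h0 : 0 ≤ r * m / R := div_nonneg (mul_nonneg hr.1 hm'.le) hR.le
    refine ⟨⌊r * m / R⌋₊, ?_, ?_, ?_⟩
    · rw [Nat.floor_lt h0, div_lt_iff₀ hR]
      nlinarith
    · have := Nat.floor_le h0
      rw [le_div_iff₀ hR] at this
      rw [div_le_iff₀ hm']
      linarith
    · have := (Nat.lt_floor_add_one (r * m / R)).le
      rw [div_le_iff₀ hR] at this
      rw [le_div_iff₀ hm']
      push_cast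
      linarith

/-- A bound by `N r^(N-1)` at the mesh points extends to a function that is affine in `r^N`
between them. -/
theorem abs_sum_min_pow_le_of_mesh (hN : N ≠ 0) (hR : 0 < R) (hm : 0 < m) {a : Fin m → ℝ}
    (h : ∀ k ≤ m, |∑ j, a j * min ((R * k / m) ^ N) ((R * (j + 1 : ℕ) / m) ^ N)|
      ≤ N * (R * k / m) ^ (N - 1)) {r : ℝ} (hr : r ∈ Icc 0 R) :
    |∑ j, a j * min (r ^ N) ((R * (j + 1 : ℕ) / m) ^ N)| ≤ N * r ^ (N - 1) := by
  obtain ⟨k, hk, hkr⟩ := exists_mesh_mem_Icc hR hm hr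
  set x := R * k / m with hx
  set y := R * (k + 1 : ℕ) / m with hy
  have hx0 : 0 ≤ x := mesh_nonneg hR k
  have hxy : x < y := mesh_lt hR hm (Nat.lt_succ_self k)
  have hy0 : 0 ≤ y := hx0.trans hxy.le
  have hseg : r ^ N ∈ segment ℝ (x ^ N) (y ^ N) := by
    rw [segment_eq_Icc (pow_le_pow_left₀ hx0 hxy.le N)]
    exact ⟨pow_le_pow_left₀ hx0 hkr.1 N, pow_le_pow_left₀ hr.1 hkr.2 N⟩
  obtain ⟨α, β, hα, hβ, hαβ, hrN⟩ := hseg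
  simp only [smul_eq_mul] at hrN
  have hmin : ∀ j : Fin m, min (r ^ N) ((R * (j + 1 : ℕ) / m) ^ N)
      = α * min (x ^ N) ((R * (j + 1 : ℕ) / m) ^ N)
        + β * min (y ^ N) ((R * (j + 1 : ℕ) / m) ^ N) := by
    intro j
    have hj0 : 0 ≤ R * (j + 1 : ℕ) / m := mesh_nonneg hR _
    rcases Nat.lt_or_ge (j : ℕ) k with hjk | hjk
    · have h1 : R * (j + 1 : ℕ) / m ≤ x := mesh_le hR hjk
      rw [min_eq_right (pow_le_pow_left₀ hj0 (h1.trans hkr.1) N),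
        min_eq_right (pow_le_pow_left₀ hj0 h1 N),
        min_eq_right (pow_le_pow_left₀ hj0 (h1.trans hxy.le) N), ← add_mul, hαβ, one_mul]
    · have h1 : y ≤ R * (j + 1 : ℕ) / m := mesh_le hR (Nat.succ_le_succ hjk)
      rw [min_eq_left (pow_le_pow_left₀ hr.1 (hkr.2.trans h1) N),
        min_eq_left (pow_le_pow_left₀ hx0 (hxy.le.trans h1) N),
        min_eq_left (pow_le_pow_left₀ hy0 h1 N), hrN]
  have hsplit : ∑ j, a j * min (r ^ N) ((R * (j + 1 : ℕ) / m) ^ N)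
      = α * (∑ j, a j * min (x ^ N) ((R * (j + 1 : ℕ) / m) ^ N))
        + β * (∑ j, a j * min (y ^ N) ((R * (j + 1 : ℕ) / m) ^ N)) := by
    rw [Finset.mul_sum, Finset.mul_sum, ← Finset.sum_add_distrib]
    refine Finset.sum_congr rfl fun j _ => ?_
    rw [hmin j]; ring
  have hconc := (concaveOn_rpow_pred_div N).2 (mem_Ici.2 (pow_nonneg hx0 N))
    (mem_Ici.2 (pow_nonneg hy0 N)) hα hβ hαβ
  simp only [smul_eq_mul] at hconc
  rw [hrN, rpow_pow_eq_pow_pred hN hx0, rpow_pow_eq_pow_pred hN hy0,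
    rpow_pow_eq_pow_pred hN hr.1] at hconc
  have h1 := h k hk.le
  have h2 := h (k + 1) hk
  rw [hsplit]
  refine (abs_add_le _ _).trans ?_
  rw [abs_mul, abs_mul, abs_of_nonneg hα, abs_of_nonneg hβ]
  calc _ ≤ α * (N * x ^ (N - 1)) + β * (N * y ^ (N - 1)) := by gcongr
    _ = N * (α * x ^ (N - 1) + β * y ^ (N - 1)) := by ring
    _ ≤ _ := by gcongr

/-- The indicators of the balls of radii `R (j + 1) / m`, `j < m`. -/
noncomputable def meshBall (N m : ℕ) (R : ℝ) (j : Fin m) :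
    L2 (Metric.ball (0 : EuclideanSpace ℝ (Fin N)) R) :=
  ballL2 N R (R * (j + 1 : ℕ) / m)

/-- The normalized indicator of the annulus between the radii `R k / m` and `R (k + 1) / m`. -/
noncomputable def meshAnnulus (N m : ℕ) (R : ℝ) (k : ℕ) :
    L2 (Metric.ball (0 : EuclideanSpace ℝ (Fin N)) R) :=
  (volume.real (Metric.ball (0 : EuclideanSpace ℝ (Fin N)) 1)
      * ((R * (k + 1 : ℕ) / m) ^ N - (R * k / m) ^ N))⁻¹ •
    (ballL2 N R (R * (k + 1 : ℕ) / m) - ballL2 N R (R * k / m))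

/-- The family biorthogonal to `meshBall`. -/
noncomputable def meshDual (N m : ℕ) (R : ℝ) (j : Fin m) :
    L2 (Metric.ball (0 : EuclideanSpace ℝ (Fin N)) R) :=
  meshAnnulus N m R j - if (j : ℕ) + 1 < m then meshAnnulus N m R (j + 1) else 0

/-- The areas of the interior mesh spheres; there is no interface on the outer one. -/
noncomputable def meshArea (N m : ℕ) (R : ℝ) (j : Fin m) : ℝ :=
  if (j : ℕ) + 1 < m then
    N * volume.real (Metric.ball (0 : EuclideanSpace ℝ (Fin N)) 1)
      * (R * (j + 1 : ℕ) / m) ^ (N - 1)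
  else 0

theorem volume_real_unitBall_pos (N : ℕ) :
    0 < volume.real (Metric.ball (0 : EuclideanSpace ℝ (Fin N)) 1) :=
  ENNReal.toReal_pos (Metric.measure_ball_pos _ _ one_pos).ne' measure_ball_lt_top.ne

theorem meshArea_nonneg (hR : 0 < R) (j : Fin m) : 0 ≤ meshArea N m R j := by
  unfold meshArea
  split_ifs <;> positivity

theorem meshArea_le (hR : 0 < R) (j : Fin m) : meshArea N m R j ≤
    N * volume.real (Metric.ball (0 : EuclideanSpace ℝ (Fin N)) 1)
      * (R * (j + 1 : ℕ) / m) ^ (N - 1) := by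
  unfold meshArea
  split_ifs
  · exact le_rfl
  · positivity

theorem ballL2_mesh_mem_span {k : ℕ} (hk : k ≤ m) :
    ballL2 N R (R * k / m) ∈ Submodule.span ℝ (range (meshBall N m R)) := by
  cases k with
  | zero => simp [ballL2_zero]
  | succ k => exact Submodule.subset_span ⟨⟨k, hk⟩, rfl⟩

theorem meshAnnulus_mem_span {k : ℕ} (hk : k < m) :
    meshAnnulus N m R k ∈ Submodule.span ℝ (range (meshBall N m R)) :=
  Submodule.smul_mem _ _ (sub_mem (ballL2_mesh_mem_span hk) (ballL2_mesh_mem_span hk.le))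

theorem meshDual_mem_span (j : Fin m) :
    meshDual N m R j ∈ Submodule.span ℝ (range (meshBall N m R)) := by
  unfold meshDual
  split_ifs with h
  · exact sub_mem (meshAnnulus_mem_span j.2) (meshAnnulus_mem_span h)
  · simpa using meshAnnulus_mem_span j.2

theorem meshVolume_pos (hN : N ≠ 0) (hR : 0 < R) (hm : 0 < m) (k : ℕ) :
    0 < volume.real (Metric.ball (0 : EuclideanSpace ℝ (Fin N)) 1)
      * ((R * (k + 1 : ℕ) / m) ^ N - (R * k / m) ^ N) :=
  mul_pos (volume_real_unitBall_pos N) (sub_pos.2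
    (pow_lt_pow_left₀ (mesh_lt hR hm (Nat.lt_succ_self k)) (mesh_nonneg hR k) hN))

theorem inner_meshAnnulus_meshBall (hN : N ≠ 0) (hR : 0 < R) (hm : 0 < m) {k : ℕ} (hk : k < m)
    (j : Fin m) : ⟪meshAnnulus N m R k, meshBall N m R j⟫ = if k ≤ j then 1 else 0 := by
  rw [meshAnnulus, meshBall, real_inner_smul_left, inner_sub_left,
    inner_ballL2_ballL2 hN (mesh_nonneg hR _) (mesh_nonneg hR _) (mesh_le_radius hR hm hk)
      (mesh_le_radius hR hm j.2),
    inner_ballL2_ballL2 hN (mesh_nonneg hR _) (mesh_nonneg hR _) (mesh_le_radius hR hm hk.le)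
      (mesh_le_radius hR hm j.2), ← mul_sub]
  split_ifs with h
  · rw [min_eq_left (pow_le_pow_left₀ (mesh_nonneg hR _) (mesh_le hR (by omega)) N),
      min_eq_left (pow_le_pow_left₀ (mesh_nonneg hR _) (mesh_le hR (by omega)) N),
      inv_mul_cancel₀ (meshVolume_pos hN hR hm k).ne']
  · rw [min_eq_right (pow_le_pow_left₀ (mesh_nonneg hR _) (mesh_le hR (by omega)) N),
      min_eq_right (pow_le_pow_left₀ (mesh_nonneg hR _) (mesh_le hR (by omega)) N)]
    simp

theorem inner_meshDual_meshBall (hN : N ≠ 0) (hR : 0 < R) (hm : 0 < m) (i j : Fin m) :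
    ⟪meshDual N m R i, meshBall N m R j⟫ = if i = j then 1 else 0 := by
  rw [meshDual, inner_sub_left, inner_meshAnnulus_meshBall hN hR hm i.2]
  simp only [Fin.ext_iff]
  by_cases h : (i : ℕ) + 1 < m
  · rw [if_pos h, inner_meshAnnulus_meshBall hN hR hm h]
    split_ifs <;> first | omega | norm_num
  · rw [if_neg h, inner_zero_left]
    split_ifs <;> first | omega | norm_num

theorem totalVariation_sum_smul_meshBall_le (hN : N ≠ 0) (hR : 0 < R) (hm : 0 < m)
    (a : Fin m → ℝ) : totalVariation (Metric.ball 0 R) (∑ j, a j • meshBall N m R j :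
      L2 (Metric.ball (0 : EuclideanSpace ℝ (Fin N)) R))
      ≤ ENNReal.ofReal (∑ j, meshArea N m R j * |a j|) := by
  refine totalVariation_le_ofReal fun φ hφ => ?_
  rw [inner_sum]
  refine Finset.sum_le_sum fun j _ => ?_
  rw [inner_smul_right, real_inner_comm]
  refine (le_abs_self _).trans ?_
  rw [abs_mul, mul_comm]
  refine mul_le_mul_of_nonneg_right ?_ (abs_nonneg _)
  unfold meshArea
  split_ifs with h
  · exact abs_inner_ballL2_divergenceL2_le hN hφ
      ((mesh_nonneg hR 0).trans_lt (mesh_lt hR hm j.1.succ_pos)) (mesh_le_radius hR hm j.2)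
  · have : (j : ℕ) + 1 = m := by omega
    rw [meshBall, this, mesh_self hm, inner_ballL2_self_divergenceL2, abs_zero]

theorem inner_le_totalVariation_of_abs_inner_meshBall_le (hN : 2 ≤ N) (hR : 0 < R) (hm : 0 < m)
    {p : L2 (Metric.ball (0 : EuclideanSpace ℝ (Fin N)) R)}
    (hp : p ∈ Submodule.span ℝ (range (meshBall N m R)))
    (hle : ∀ j, |⟪p, meshBall N m R j⟫| ≤ meshArea N m R j)
    (w : L2 (Metric.ball (0 : EuclideanSpace ℝ (Fin N)) R))
    (hw : totalVariation (Metric.ball 0 R) w < ∞) :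
    ⟪p, w⟫ ≤ (totalVariation (Metric.ball 0 R) w).toReal := by
  have hN0 : N ≠ 0 := by omega
  have hω := volume_real_unitBall_pos N
  set ω := volume.real (Metric.ball (0 : EuclideanSpace ℝ (Fin N)) 1) with hωdef
  obtain ⟨a, rfl⟩ := (Submodule.mem_span_range_iff_exists_fun ℝ).1 hp
  have hin : ∀ k : Fin m, ⟪∑ j, a j • meshBall N m R j, meshBall N m R k⟫
      = ω * ∑ j, a j * min ((R * (k + 1 : ℕ) / m) ^ N) ((R * (j + 1 : ℕ) / m) ^ N) := by
    intro k
    rw [sum_inner, Finset.mul_sum]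
    refine Finset.sum_congr rfl fun j _ => ?_
    rw [real_inner_smul_left, meshBall, meshBall, inner_ballL2_ballL2 hN0 (mesh_nonneg hR _)
      (mesh_nonneg hR _) (mesh_le_radius hR hm j.2) (mesh_le_radius hR hm k.2), min_comm]
    ring
  refine inner_sum_smul_ballL2_le hN0 (μ := R * (1 : ℕ) / m)
    ((mesh_nonneg hR 0).trans_lt (mesh_lt hR hm one_pos)) (fun j => mesh_le hR (by omega))
    (fun j => mesh_le_radius hR hm j.2) hR ?_ (fun r hr => ?_) hw
  · have h1 := hle ⟨m - 1, by omega⟩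
    have h2 : m - 1 + 1 = m := by omega
    rw [meshArea, hin] at h1
    simp only [h2, lt_irrefl, if_false, mesh_self hm] at h1
    have h3 := abs_nonpos_iff.1 h1
    rw [mul_eq_zero, or_iff_right hω.ne'] at h3
    rw [← h3]
    refine Finset.sum_congr rfl fun j _ => ?_
    rw [min_eq_right (pow_le_pow_left₀ (mesh_nonneg hR _) (mesh_le_radius hR hm j.2) N)]
  · refine abs_sum_min_pow_le_of_mesh hN0 hR hm (fun k hk => ?_) hr
    cases k with
    | zero =>
      have : ∀ j : Fin m, min ((0 : ℝ) ^ N) ((R * (j + 1 : ℕ) / m) ^ N) = 0 := fun j => by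
        rw [zero_pow hN0, min_eq_left (pow_nonneg (mesh_nonneg hR _) N)]
      have hN1 : N - 1 ≠ 0 := by omega
      simp only [Nat.cast_zero, mul_zero, zero_div, this, Finset.sum_const_zero, abs_zero,
        zero_pow hN1, le_refl]
    | succ k =>
      have h1 := (hle ⟨k, hk⟩).trans (meshArea_le hR _)
      rw [hin, abs_mul, abs_of_pos hω, ← hωdef] at h1
      refine le_of_mul_le_mul_left (h1.trans_eq ?_) hω
      ring

theorem inner_meshDual_nonneg (hN : 2 ≤ N) (hR : 0 < R) (hm : 0 < m)
    {q : L2 (Metric.ball (0 : EuclideanSpace ℝ (Fin N)) R)}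
    (hle : ∀ j, |⟪q, meshBall N m R j⟫| ≤ meshArea N m R j) (j : Fin m)
    (hpos : 0 < meshArea N m R j) (heq : ⟪q, meshBall N m R j⟫ = meshArea N m R j) :
    0 ≤ ⟪meshDual N m R j, q⟫ := by
  have hN0 : N ≠ 0 := by omega
  have hω := volume_real_unitBall_pos N
  set ω := volume.real (Metric.ball (0 : EuclideanSpace ℝ (Fin N)) 1) with hωdef
  have hj : (j : ℕ) + 1 < m := by
    by_contra h
    rw [meshArea, if_neg h] at hpos
    exact lt_irrefl _ hpos
  have hF : ∀ k ≤ m, ⟪ballL2 N R (R * k / m), q⟫ ≤ N * ω * (R * k / m) ^ (N - 1) := by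
    intro k hk
    cases k with
    | zero =>
      simp only [Nat.cast_zero, mul_zero, zero_div, ballL2_zero, inner_zero_left]
      positivity
    | succ k =>
      rw [real_inner_comm]
      exact ((le_abs_self _).trans (hle ⟨k, hk⟩)).trans (meshArea_le hR _)
  have h0 := hF j j.2.le
  have h2 := hF (j + 1 + 1) hj
  have h1 : ⟪ballL2 N R (R * (j + 1 : ℕ) / m), q⟫
      = N * ω * (R * (j + 1 : ℕ) / m) ^ (N - 1) := by
    rw [real_inner_comm]
    rw [meshArea, if_pos hj] at heq
    exact heq
  have hV1 := meshVolume_pos hN0 hR hm j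
  have hV2 := meshVolume_pos hN0 hR hm (j + 1)
  rw [← hωdef] at hV1 hV2
  have hs := pow_pred_slope_anti hN0 (mesh_nonneg (m := m) hR j)
    (mesh_lt hR hm (Nat.lt_succ_self j)) (mesh_lt hR hm (Nat.lt_succ_self (j + 1)))
  simp only [Nat.succ_eq_add_one] at hs
  rw [meshDual, if_pos hj, inner_sub_left, meshAnnulus, meshAnnulus, real_inner_smul_left,
    real_inner_smul_left, inner_sub_left, inner_sub_left, h1, sub_nonneg, ← hωdef]
  set x := R * (j : ℕ) / m
  set y := R * ((j : ℕ) + 1 : ℕ) / m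
  set z := R * ((j : ℕ) + 1 + 1 : ℕ) / m
  have hd1 : 0 < y ^ N - x ^ N := pos_of_mul_pos_right hV1 hω.le
  have hd2 : 0 < z ^ N - y ^ N := pos_of_mul_pos_right hV2 hω.le
  calc _ ≤ (ω * (z ^ N - y ^ N))⁻¹ * (N * ω * z ^ (N - 1) - N * ω * y ^ (N - 1)) := by gcongr
    _ = N * ((z ^ (N - 1) - y ^ (N - 1)) / (z ^ N - y ^ N)) := by field_simp
    _ ≤ N * ((y ^ (N - 1) - x ^ (N - 1)) / (y ^ N - x ^ N)) := by gcongr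
    _ = (ω * (y ^ N - x ^ N))⁻¹ * (N * ω * y ^ (N - 1) - N * ω * x ^ (N - 1)) := by field_simp
    _ ≤ _ := by gcongr

theorem exists_resolvent_curve_of_mem_span_meshBall (hN : 2 ≤ N) (hR : 0 < R) (hm : 0 < m)
    {g : L2 (Metric.ball (0 : EuclideanSpace ℝ (Fin N)) R)}
    (hg : g ∈ Submodule.span ℝ (range (meshBall N m R))) :
    ∃ (v : ℝ → L2 (Metric.ball (0 : EuclideanSpace ℝ (Fin N)) R)) (L : ℝ≥0),
      v 0 = g ∧ LipschitzOnWith L v (Ici 0) ∧ ∀ s t, 0 ≤ s → s < t →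
        (t - s)⁻¹ • (v s - v t) ∈ subdifferential
          (fun w : L2 (Metric.ball (0 : EuclideanSpace ℝ (Fin N)) R) =>
            totalVariation (Metric.ball 0 R) w) (v t) := by
  have hN0 : N ≠ 0 := by omega
  exact exists_resolvent_curve (meshArea_nonneg hR) (inner_meshDual_meshBall hN0 hR hm)
    meshDual_mem_span (totalVariation_sum_smul_meshBall_le hN0 hR hm)
    (fun p hp hle w hw => inner_le_totalVariation_of_abs_inner_meshBall_le hN hR hm hp hle w hw)
    (fun q _ hle j hpos heq => inner_meshDual_nonneg hN hR hm hle j hpos heq) hg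

end Mesh

section Density

variable {N : ℕ} {R : ℝ}

theorem map_norm_restrict_ball_absolutelyContinuous (hN : N ≠ 0) :
    (volume.restrict (Metric.ball (0 : EuclideanSpace ℝ (Fin N)) R)).map (fun x => ‖x‖)
      ≪ volume.restrict (Ioo 0 R) := by
  have : Nonempty (Fin N) := Fin.pos_iff_nonempty.1 (Nat.pos_of_ne_zero hN)
  refine Measure.AbsolutelyContinuous.mk fun A hA hA0 => ?_
  rw [Measure.map_apply (by fun_prop) hA, Measure.restrict_apply (by measurability)]
  rw [Measure.restrict_apply hA] at hA0
  set S : Set ℝ := A ∩ Iio R with hS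
  have hSm : MeasurableSet S := hA.inter measurableSet_Iio
  have heq : (fun x : EuclideanSpace ℝ (Fin N) => ‖x‖) ⁻¹' A ∩ Metric.ball 0 R
      = {x | ‖x‖ ∈ S} := by
    ext x; simp [hS]
  have hSm' : MeasurableSet {x : EuclideanSpace ℝ (Fin N) | ‖x‖ ∈ S} :=
    measurableSet_preimage (by fun_prop : Measurable fun x : EuclideanSpace ℝ (Fin N) => ‖x‖) hSm
  have h1 := integral_fun_norm_addHaar (volume : Measure (EuclideanSpace ℝ (Fin N)))
    (S.indicator fun _ => (1 : ℝ))
  have h2 : ∫ y in Ioi (0 : ℝ), y ^ (Module.finrank ℝ (EuclideanSpace ℝ (Fin N)) - 1) •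
      S.indicator (fun _ => (1 : ℝ)) y = 0 := by
    refine integral_eq_zero_of_ae ?_
    rw [EventuallyEq, ae_restrict_iff' measurableSet_Ioi]
    filter_upwards [measure_eq_zero_iff_ae_notMem.1 hA0] with y hy hy0
    have : y ∉ S := fun h => hy ⟨h.1, hy0, h.2⟩
    simp [this]
  rw [h2, smul_zero, smul_zero] at h1
  have h3 : ∀ x : EuclideanSpace ℝ (Fin N), S.indicator (fun _ => (1 : ℝ)) ‖x‖
      = {x : EuclideanSpace ℝ (Fin N) | ‖x‖ ∈ S}.indicator (fun _ => (1 : ℝ)) x := fun x => rfl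
  simp only [h3] at h1
  rw [integral_indicator_const _ hSm', smul_eq_mul, mul_one] at h1
  rw [heq]
  refine (measureReal_eq_zero_iff ?_).1 h1
  refine ((measure_mono fun x hx => ?_).trans_lt
    (measure_ball_lt_top (x := (0 : EuclideanSpace ℝ (Fin N))) (r := R))).ne
  exact mem_ball_zero_iff.2 hx.2

instance isFiniteMeasure_restrict_ball :
    IsFiniteMeasure (volume.restrict (Metric.ball (0 : EuclideanSpace ℝ (Fin N)) R)) :=
  ⟨by simpa using measure_ball_lt_top⟩

/-- The profile of a radial function of `L²` is in `L²` of the distribution of the norm. -/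
theorem memLp_map_norm_of_ae_eq (hN : N ≠ 0)
    {g : L2 (Metric.ball (0 : EuclideanSpace ℝ (Fin N)) R)} {h : ℝ → ℝ}
    (hg : ∀ᵐ x ∂(volume.restrict (Metric.ball 0 R)), g x = h ‖x‖) :
    MemLp h 2 ((volume.restrict (Metric.ball (0 : EuclideanSpace ℝ (Fin N)) R)).map
      (fun x => ‖x‖)) := by
  have : Nonempty (Fin N) := Fin.pos_iff_nonempty.1 (Nat.pos_of_ne_zero hN)
  have hmem : MemLp (fun x => h ‖x‖) 2
      (volume.restrict (Metric.ball (0 : EuclideanSpace ℝ (Fin N)) R)) :=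
    (memLp_congr_ae hg).1 (Lp.memLp g)
  have hint : IntegrableOn (fun x => h ‖x‖) (Metric.ball (0 : EuclideanSpace ℝ (Fin N)) R) :=
    hmem.integrable (by norm_num)
  rw [integrableOn_fun_norm_addHaar] at hint
  have hm : AEStronglyMeasurable h (volume.restrict (Ioo 0 R)) := by
    have h1 := (Continuous.aestronglyMeasurable (μ := volume.restrict (Ioo 0 R))
      (by fun_prop : Continuous fun y : ℝ =>
        y ^ (Module.finrank ℝ (EuclideanSpace ℝ (Fin N)) - 1))).aemeasurable.inv.aestronglyMeasurable
    refine (h1.mul hint.aestronglyMeasurable).congr ?_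
    filter_upwards [ae_restrict_mem measurableSet_Ioo] with y hy
    have : y ^ (Module.finrank ℝ (EuclideanSpace ℝ (Fin N)) - 1) ≠ 0 := pow_ne_zero _ hy.1.ne'
    simp only [Pi.mul_apply, Pi.inv_apply, smul_eq_mul]
    field_simp
  rw [memLp_map_measure_iff (hm.mono_ac (map_norm_restrict_ball_absolutelyContinuous hN))
    (by fun_prop)]
  exact hmem

/-- A continuous radial function is uniformly close to radial step functions. -/
theorem exists_mem_span_meshBall_abs_sub_le (hR : 0 < R) {κ : ℝ → ℝ} (hκ : UniformContinuous κ)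
    {ε : ℝ} (hε : 0 < ε) : ∃ m, 0 < m ∧ ∃ g ∈ Submodule.span ℝ (range (meshBall N m R)),
      ∀ᵐ x ∂(volume.restrict (Metric.ball (0 : EuclideanSpace ℝ (Fin N)) R)),
        |κ ‖x‖ - g x| ≤ ε := by
  obtain ⟨η, hη, hκη⟩ := Metric.uniformContinuous_iff.1 hκ ε hε
  obtain ⟨n, hn⟩ := exists_nat_gt (R / η)
  refine ⟨n + 1, n.succ_pos, ∑ j ∈ Finset.range (n + 1), κ (R * j / (n + 1 : ℕ)) •
    (ballL2 N R (R * (j + 1 : ℕ) / (n + 1 : ℕ)) - ballL2 N R (R * j / (n + 1 : ℕ))), ?_, ?_⟩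
  · refine sum_mem fun j hj => Submodule.smul_mem _ _ ?_
    rw [Finset.mem_range] at hj
    exact sub_mem (ballL2_mesh_mem_span hj) (ballL2_mesh_mem_span hj.le)
  set ind : ℕ → EuclideanSpace ℝ (Fin N) → ℝ := fun k =>
    (Metric.ball 0 (R * k / (n + 1 : ℕ))).indicator fun _ => (1 : ℝ) with hinddef
  have hind : ∀ k : ℕ, ⇑(ballL2 N R (R * k / (n + 1 : ℕ))) =ᵐ[volume.restrict (Metric.ball 0 R)]
      ind k := fun k => indicatorConstLp_coeFn
  have hterm : ∀ j : ℕ, ⇑(κ (R * j / (n + 1 : ℕ)) •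
      (ballL2 N R (R * (j + 1 : ℕ) / (n + 1 : ℕ)) - ballL2 N R (R * j / (n + 1 : ℕ))))
      =ᵐ[volume.restrict (Metric.ball 0 R)]
      fun x => κ (R * j / (n + 1 : ℕ)) * (ind (j + 1) x - ind j x) := by
    intro j
    refine (Lp.coeFn_smul _ _).trans ?_
    filter_upwards [Lp.coeFn_sub (ballL2 N R (R * (j + 1 : ℕ) / (n + 1 : ℕ)))
      (ballL2 N R (R * j / (n + 1 : ℕ))), hind j, hind (j + 1)] with x h1 h2 h3
    rw [Pi.smul_apply, h1, Pi.sub_apply, h2, h3, smul_eq_mul]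
  filter_upwards [Lp.coeFn_finsetSum (Finset.range (n + 1)) fun j : ℕ => κ (R * j / (n + 1 : ℕ)) •
    (ballL2 N R (R * (j + 1 : ℕ) / (n + 1 : ℕ)) - ballL2 N R (R * j / (n + 1 : ℕ))),
    ae_all_iff.2 hterm, ae_restrict_mem Metric.isOpen_ball.measurableSet] with x h1 h2 hx
  rw [h1, Finset.sum_apply]
  simp only [h2]
  have htel : ∑ j ∈ Finset.range (n + 1), (ind (j + 1) x - ind j x) = 1 := by
    rw [Finset.sum_range_sub fun k => ind k x]
    simp [hinddef, mesh_self (R := R) n.succ_pos, -Nat.cast_add, hx]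
  have hmono : ∀ j : ℕ, 0 ≤ ind (j + 1) x - ind j x := fun j => sub_nonneg.2 <|
    indicator_le_indicator_of_subset
      (Metric.ball_subset_ball (mesh_le hR j.le_succ)) (fun _ => zero_le_one) x
  have hbound : ∀ j : ℕ, |(κ ‖x‖ - κ (R * j / (n + 1 : ℕ))) * (ind (j + 1) x - ind j x)|
      ≤ ε * (ind (j + 1) x - ind j x) := by
    intro j
    rw [abs_mul, abs_of_nonneg (hmono j)]
    by_cases hj : x ∈ Metric.ball 0 (R * (j + 1 : ℕ) / (n + 1 : ℕ))
        ∧ x ∉ Metric.ball 0 (R * j / (n + 1 : ℕ))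
    · refine mul_le_mul_of_nonneg_right ?_ (hmono j)
      rw [← Real.dist_eq]
      refine (hκη ?_).le
      rw [mem_ball_zero_iff, mem_ball_zero_iff, not_lt] at hj
      rw [Real.dist_eq, abs_of_nonneg (sub_nonneg.2 hj.2)]
      have h3 : R * (j + 1 : ℕ) / (n + 1 : ℕ) - R * j / (n + 1 : ℕ) = R / (n + 1 : ℕ) := by
        push_cast; ring
      have h4 : R / (n + 1 : ℕ) < η := by
        rw [div_lt_iff₀ hη] at hn
        rw [div_lt_iff₀ (by positivity)]
        push_cast
        nlinarith
      linarith [hj.1]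
    · have : ind (j + 1) x - ind j x = 0 := by
        have hsub : x ∈ Metric.ball 0 (R * j / (n + 1 : ℕ)) →
            x ∈ Metric.ball 0 (R * (j + 1 : ℕ) / (n + 1 : ℕ)) :=
          fun h => Metric.ball_subset_ball (mesh_le hR j.le_succ) h
        by_cases h5 : x ∈ Metric.ball 0 (R * j / (n + 1 : ℕ))
        · simp only [hinddef]
          rw [indicator_of_mem h5, indicator_of_mem (hsub h5), sub_self]
        · have h6 : x ∉ Metric.ball 0 (R * (j + 1 : ℕ) / (n + 1 : ℕ)) := fun h => hj ⟨h, h5⟩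
          simp only [hinddef]
          rw [indicator_of_notMem h5, indicator_of_notMem h6, sub_self]
      rw [this]; simp
  have hsplit : κ ‖x‖ - ∑ j ∈ Finset.range (n + 1), κ (R * j / (n + 1 : ℕ)) *
      (ind (j + 1) x - ind j x) = ∑ j ∈ Finset.range (n + 1),
        (κ ‖x‖ - κ (R * j / (n + 1 : ℕ))) * (ind (j + 1) x - ind j x) := by
    simp only [sub_mul (κ ‖x‖)]
    rw [Finset.sum_sub_distrib, ← Finset.mul_sum, htel, mul_one]
  rw [hsplit]
  calc _ ≤ ∑ j ∈ Finset.range (n + 1), ε * (ind (j + 1) x - ind j x) :=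
        (Finset.abs_sum_le_sum_abs _ _).trans (Finset.sum_le_sum fun j _ => hbound j)
    _ = ε := by rw [← Finset.mul_sum, htel, mul_one]

/-- Radial step functions are dense in the radial functions of `L²`. -/
theorem exists_mem_span_meshBall_norm_sub_le (hN : N ≠ 0) (hR : 0 < R)
    {g : L2 (Metric.ball (0 : EuclideanSpace ℝ (Fin N)) R)}
    (hg : IsRadial (Metric.ball (0 : EuclideanSpace ℝ (Fin N)) R) g) {ε : ℝ} (hε : 0 < ε) :
    ∃ m, 0 < m ∧ ∃ g' ∈ Submodule.span ℝ (range (meshBall N m R)), ‖g - g'‖ ≤ ε := by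
  obtain ⟨h, hh⟩ := hg
  set μ := volume.restrict (Metric.ball (0 : EuclideanSpace ℝ (Fin N)) R) with hμ
  have hmem := memLp_map_norm_of_ae_eq hN hh
  obtain ⟨κ, hκs, hκ, hκc, -⟩ := hmem.exists_hasCompactSupport_eLpNorm_sub_le (by norm_num)
    (ε := ENNReal.ofReal (ε / 2)) (by simpa using hε)
  have hκu : UniformContinuous κ := hκs.uniformContinuous_of_continuous hκc
  have hfin : μ univ ^ (2 : ℝ≥0∞).toReal⁻¹ ≠ ∞ :=
    ENNReal.rpow_ne_top_of_nonneg (by positivity) (measure_ne_top _ _)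
  set V : ℝ := (μ univ ^ (2 : ℝ≥0∞).toReal⁻¹).toReal with hV
  have hV0 : 0 ≤ V := ENNReal.toReal_nonneg
  obtain ⟨m, hm, g', hg', hle⟩ := exists_mem_span_meshBall_abs_sub_le (N := N) hR hκu
    (ε := ε / (2 * (V + 1))) (by positivity)
  refine ⟨m, hm, g', hg', ?_⟩
  have hκm : AEStronglyMeasurable (fun x : EuclideanSpace ℝ (Fin N) => κ ‖x‖) μ :=
    Continuous.aestronglyMeasurable (by fun_prop)
  have h1 : eLpNorm (fun x => g x - κ ‖x‖) 2 μ ≤ ENNReal.ofReal (ε / 2) := by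
    rw [eLpNorm_map_measure (hmem.1.sub hκc.aestronglyMeasurable) (by fun_prop)] at hκ
    refine (eLpNorm_congr_ae ?_).trans_le hκ
    filter_upwards [hh] with x hx
    simp [hx]
  have h2 : eLpNorm (fun x => κ ‖x‖ - g' x) 2 μ ≤ ENNReal.ofReal (ε / 2) := by
    refine (eLpNorm_le_of_ae_bound (C := ε / (2 * (V + 1))) hle).trans ?_
    rw [← ENNReal.ofReal_toReal hfin, ← hV, ← ENNReal.ofReal_mul hV0]
    refine ENNReal.ofReal_le_ofReal ?_
    rw [mul_div_assoc', div_le_div_iff₀ (by positivity) two_pos]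
    nlinarith
  have h3 : eLpNorm (g - g' : L2 (Metric.ball (0 : EuclideanSpace ℝ (Fin N)) R)) 2 μ
      ≤ ENNReal.ofReal ε := by
    have h4 : ⇑(g - g') =ᵐ[μ] (fun x => g x - κ ‖x‖) + fun x => κ ‖x‖ - g' x := by
      filter_upwards [Lp.coeFn_sub g g'] with x hx
      rw [hx]; simp
    rw [eLpNorm_congr_ae h4]
    refine (eLpNorm_add_le ((Lp.aestronglyMeasurable g).sub hκm)
      (hκm.sub (Lp.aestronglyMeasurable g')) (by norm_num)).trans ?_
    refine (add_le_add h1 h2).trans_eq ?_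
    rw [← ENNReal.ofReal_add (by positivity) (by positivity), add_halves]
  rw [Lp.norm_def]
  exact ENNReal.toReal_le_of_le_ofReal hε.le h3

end Density

section Denoising

variable {N : ℕ} {Ω : Set (EuclideanSpace ℝ (Fin N))}

theorem totalVariation_zero_lt_top : totalVariation Ω (0 : L2 Ω) < ∞ :=
  (totalVariation_le_ofReal (C := 0) fun φ hφ => by simp).trans_lt ENNReal.ofReal_lt_top

/-- The graph of the subdifferential of the total variation is closed. -/
theorem mem_subdifferential_totalVariation_of_tendsto {p v : ℕ → L2 Ω} {p' v' : L2 Ω}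
    (hp : Tendsto p atTop (𝓝 p')) (hv : Tendsto v atTop (𝓝 v'))
    (h : ∀ n, p n ∈ subdifferential (fun w : L2 Ω => totalVariation Ω w) (v n)) :
    p' ∈ subdifferential (fun w : L2 Ω => totalVariation Ω w) v' := by
  simp only [mem_subdifferential_iff] at h ⊢
  have key : ∀ w : L2 Ω, totalVariation Ω w < ∞ → ∀ φ (hφ : φ ∈ testFields Ω),
      ⟪divergenceL2 hφ, v'⟫ ≤ (totalVariation Ω w).toReal - ⟪p', w - v'⟫ := by
    intro w hw φ hφ
    refine le_of_tendsto_of_tendsto' (tendsto_const_nhds.inner hv)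
      (tendsto_const_nhds.sub (hp.inner (tendsto_const_nhds.sub hv))) fun n => ?_
    linarith [inner_divergenceL2_le hφ (h n).1, (h n).2 w hw]
  have hle := fun w hw => totalVariation_le_ofReal (key w hw)
  refine ⟨(hle 0 totalVariation_zero_lt_top).trans_lt ENNReal.ofReal_lt_top, fun w hw => ?_⟩
  have h0 : 0 ≤ (totalVariation Ω w).toReal - ⟪p', w - v'⟫ := by
    refine ge_of_tendsto' (tendsto_const_nhds.sub (hp.inner (tendsto_const_nhds.sub hv)))
      fun n => ?_
    linarith [(h n).2 w hw, ENNReal.toReal_nonneg (a := totalVariation Ω (v n))]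
  linarith [ENNReal.toReal_le_of_le_ofReal h0 (hle w hw)]

theorem totalVariation_congr_ae {u v : EuclideanSpace ℝ (Fin N) → ℝ}
    (h : u =ᵐ[volume.restrict Ω] v) : totalVariation Ω u = totalVariation Ω v := by
  unfold totalVariation
  refine iSup_congr fun φ => iSup_congr fun _ => ?_
  congr 1
  refine integral_congr_ae ?_
  filter_upwards [h] with x hx
  rw [hx]

theorem rofEnergy_congr_ae {lam : ℝ} {g u v : EuclideanSpace ℝ (Fin N) → ℝ}
    (h : u =ᵐ[volume.restrict Ω] v) : rofEnergy Ω lam g u = rofEnergy Ω lam g v := by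
  unfold rofEnergy
  rw [totalVariation_congr_ae h]
  congr 3
  refine eLpNorm_congr_ae ?_
  filter_upwards [h] with x hx
  rw [hx]

theorem rofEnergy_eq_ofReal {lam : ℝ} (hlam : 0 ≤ lam) {g w : L2 Ω}
    (hw : totalVariation Ω w < ∞) : rofEnergy Ω lam g w
      = ENNReal.ofReal (lam * (totalVariation Ω w).toReal + ‖w - g‖ ^ 2 / 2) := by
  have h1 : eLpNorm (fun x => w x - g x) 2 (volume.restrict Ω) = ENNReal.ofReal ‖w - g‖ := by
    rw [Lp.norm_def, ENNReal.ofReal_toReal (Lp.eLpNorm_ne_top _)]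
    exact (eLpNorm_congr_ae (Lp.coeFn_sub w g)).symm
  rw [rofEnergy, h1, ENNReal.ofReal_add (mul_nonneg hlam ENNReal.toReal_nonneg) (by positivity),
    ENNReal.ofReal_mul hlam, ENNReal.ofReal_toReal hw.ne, div_eq_inv_mul,
    ENNReal.ofReal_mul (by norm_num), ENNReal.ofReal_pow (norm_nonneg _),
    ENNReal.ofReal_inv_of_pos two_pos]
  norm_num

theorem exists_L2_ae_eq_of_rofEnergy_lt_top {lam : ℝ} {g : L2 Ω}
    {v : EuclideanSpace ℝ (Fin N) → ℝ} (hv : IsBV Ω v) (h : rofEnergy Ω lam g v < ∞) :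
    ∃ w : L2 Ω, v =ᵐ[volume.restrict Ω] w := by
  have h1 : eLpNorm (fun x => v x - g x) 2 (volume.restrict Ω) < ∞ := by
    by_contra! h2
    rw [top_le_iff] at h2
    rw [rofEnergy, h2] at h
    simp at h
  have h2 : MemLp (fun x => v x - g x) 2 (volume.restrict Ω) :=
    ⟨hv.1.aestronglyMeasurable.sub (Lp.aestronglyMeasurable g), h1⟩
  have h3 : MemLp v 2 (volume.restrict Ω) := by
    convert h2.add (Lp.memLp g) using 1
    ext x; simp
  exact ⟨h3.toLp v, h3.coeFn_toLp.symm⟩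

/-- The optimality condition of the Rudin–Osher–Fatemi problem is sufficient, and its solution
is the only minimizer. -/
theorem isROFMinimizer_of_mem_subdifferential [IsFiniteMeasure (volume.restrict Ω)] {t : ℝ}
    (ht : 0 < t) {g u : L2 Ω}
    (h : t⁻¹ • (g - u) ∈ subdifferential (fun w : L2 Ω => totalVariation Ω w) u) :
    IsROFMinimizer Ω t g u ∧
      ∀ v, IsROFMinimizer Ω t g v → v =ᵐ[volume.restrict Ω] u := by
  rw [mem_subdifferential_iff] at h
  have hreal : ∀ w : L2 Ω, totalVariation Ω w < ∞ →
      t * (totalVariation Ω u).toReal + ‖u - g‖ ^ 2 / 2 + ‖w - u‖ ^ 2 / 2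
        ≤ t * (totalVariation Ω w).toReal + ‖w - g‖ ^ 2 / 2 := by
    intro w hw
    have h1 := h.2 w hw
    rw [real_inner_smul_left] at h1
    have h2 : ‖w - g‖ ^ 2 = ‖w - u‖ ^ 2 + ‖u - g‖ ^ 2 - 2 * ⟪g - u, w - u⟫ := by
      have : w - g = (w - u) - (g - u) := by abel
      rw [this, norm_sub_sq_real, real_inner_comm, norm_sub_rev g u]
      ring
    have h3 := mul_le_mul_of_nonneg_left h1 ht.le
    rw [mul_add, mul_inv_cancel_left₀ ht.ne'] at h3
    linarith
  have hBV : IsBV Ω u := ⟨(Lp.memLp u).integrable (by norm_num), h.1⟩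
  have hE : rofEnergy Ω t g u < ∞ := by
    rw [rofEnergy_eq_ofReal ht.le h.1]; exact ENNReal.ofReal_lt_top
  refine ⟨⟨hBV, fun v hv => ?_⟩, fun v hv => ?_⟩
  · by_cases hfin : rofEnergy Ω t g v < ∞
    · obtain ⟨w, hw⟩ := exists_L2_ae_eq_of_rofEnergy_lt_top hv hfin
      have hw' : totalVariation Ω w < ∞ := totalVariation_congr_ae hw ▸ hv.2
      rw [rofEnergy_congr_ae hw, rofEnergy_eq_ofReal ht.le h.1, rofEnergy_eq_ofReal ht.le hw']
      refine ENNReal.ofReal_le_ofReal ?_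
      nlinarith [hreal w hw', sq_nonneg ‖w - u‖]
    · rw [not_lt_top_iff.1 hfin]; exact le_top
  · have hle := hv.2 u hBV
    obtain ⟨w, hw⟩ := exists_L2_ae_eq_of_rofEnergy_lt_top hv.1 (hle.trans_lt hE)
    have hw' : totalVariation Ω w < ∞ := totalVariation_congr_ae hw ▸ hv.1.2
    rw [rofEnergy_congr_ae hw, rofEnergy_eq_ofReal ht.le h.1, rofEnergy_eq_ofReal ht.le hw',
      ENNReal.ofReal_le_ofReal_iff
        (add_nonneg (mul_nonneg ht.le ENNReal.toReal_nonneg) (by positivity))] at hle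
    have h1 : ‖w - u‖ ^ 2 ≤ 0 := by linarith [hreal w hw']
    have h2 : w = u := by
      rw [← sub_eq_zero, ← norm_eq_zero]
      exact pow_eq_zero_iff two_ne_zero |>.1 (le_antisymm h1 (sq_nonneg _))
    exact h2 ▸ hw

end Denoising

theorem mainTheorem1 (N : ℕ) (hN : 2 ≤ N) (R : ℝ) (hR : 0 < R)
    (g : L2 (Metric.ball (0 : EuclideanSpace ℝ (Fin N)) R))
    (hg : IsRadial (Metric.ball (0 : EuclideanSpace ℝ (Fin N)) R) g)
    (T : ℝ) (hT : 0 < T)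
    (u : ℝ → L2 (Metric.ball (0 : EuclideanSpace ℝ (Fin N)) R))
    (hu : IsTVFlow (Metric.ball (0 : EuclideanSpace ℝ (Fin N)) R) T u) (hu0 : u 0 = g) :
    ∀ t ∈ Ioc 0 T,
      IsROFMinimizer (Metric.ball (0 : EuclideanSpace ℝ (Fin N)) R) t g (u t) ∧
      ∀ v : EuclideanSpace ℝ (Fin N) → ℝ,
        IsROFMinimizer (Metric.ball (0 : EuclideanSpace ℝ (Fin N)) R) t g v →
          v =ᵐ[volume.restrict (Metric.ball (0 : EuclideanSpace ℝ (Fin N)) R)] u t := by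
  intro t ht
  refine isROFMinimizer_of_mem_subdifferential ht.1 ?_
  have happrox : ∀ n : ℕ, ∃ gn vn : L2 (Metric.ball (0 : EuclideanSpace ℝ (Fin N)) R),
      dist gn g ≤ 1 / ((n : ℝ) + 1) ∧ dist vn (u t) ≤ 1 / ((n : ℝ) + 1) ∧
      t⁻¹ • (gn - vn) ∈ subdifferential
        (fun w : L2 (Metric.ball (0 : EuclideanSpace ℝ (Fin N)) R) =>
          totalVariation (Metric.ball 0 R) w) vn := by
    intro n
    obtain ⟨m, hm, gn, hgn, hle⟩ := exists_mem_span_meshBall_norm_sub_le (by omega) hR hg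
      (ε := 1 / ((n : ℝ) + 1)) (by positivity)
    obtain ⟨v, L, hv0, hvL, hv⟩ := exists_resolvent_curve_of_mem_span_meshBall hN hR hm hgn
    refine ⟨gn, v t, ?_, ?_, ?_⟩
    · rwa [dist_comm, dist_eq_norm]
    · rw [dist_comm, dist_eq_norm]
      refine (norm_sub_le_of_gradientFlow hu.continuousOn hu.absolutelyContinuous hu.inclusion
        hvL hv t (Ioc_subset_Icc_self ht)).trans ?_
      rwa [hu0, hv0]
    · simpa [hv0] using hv 0 t le_rfl ht.1
  choose gn vn hgn hvn hsub using happrox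
  have hg' : Tendsto gn atTop (𝓝 g) := tendsto_iff_dist_tendsto_zero.2
    (squeeze_zero (fun _ => dist_nonneg) hgn tendsto_one_div_add_atTop_nhds_zero_nat)
  have hv' : Tendsto vn atTop (𝓝 (u t)) := tendsto_iff_dist_tendsto_zero.2
    (squeeze_zero (fun _ => dist_nonneg) hvn tendsto_one_div_add_atTop_nhds_zero_nat)
  exact mem_subdifferential_totalVariation_of_tendsto ((hg'.sub hv').const_smul t⁻¹) hv' hsub
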